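/- Let $D$ be a finite set. An operator $\varphi:D^3\to D$ is Mal'tsev if $\varphi(x,y,y)=\varphi(y,y,x)=x$ for all $x,y\in D$. A predicate $R\subseteq D^r$ ($r\ge 1$) is a Mal'tsev predicate if there is a Mal'tsev operator $\varphi$ on $D$ such that $(\varphi(a_1,b_1,c_1),\dots,\varphi(a_r,b_r,c_r))\in R$ for all $a,b,c\in R$. Write $\overline R=D^r\setminus R$. For a predicate $P\subseteq D^r$, an instance of $\mathrm{CSP}(P)$ on $n$ variables is a pair $(X,Y)$ with $|X|=n$ and $Y\subseteq X^r$; it is weighted if it comes with $w:Y\to\mathbb R_{>0}$ (an unweighted instance has $w\equiv 1$). For $\sigma:X\to D$ and $v:Y\to\mathbb R_{\ge 0}$ put $\mathrm{wt}(v,\sigma)=\sum_{y\in Y} v(y)\,\mathbf 1[(\sigma(y_1),\dots,\sigma(y_r))\in P]$. A $(w,\varepsilon)$-sparsifier is a function $v:Y\to\mathbb R_{\ge 0}$ with $(1-\varepsilon)\,\mathrm{wt}(w,\sigma)\le \mathrm{wt}(v,\sigma)\le(1+\varepsilon)\,\mathrm{wt}(w,\sigma)$ for all $\sigma:X\to D$.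 The $\varepsilon$-sparsity of the instance is the least size $|\{y: v(y)>0\}|$ of the support of a $(w,\varepsilon)$-sparsifier. Let $\mathrm{SPR}(P,n,\varepsilon)$ (respectively $\mathrm{wSPR}(P,n,\varepsilon)$) be the maximum $\varepsilon$-sparsity of an unweighted (respectively weighted) instance of $\mathrm{CSP}(P)$ on $n$ variables. Theorem. For every finite set $D$ there is a constant $C_D$ such that for every $r\ge1$, every Mal'tsev predicate $R\subseteq D^r$, every integer $n\ge 2$ and every $\varepsilon\in(0,1)$, $$\mathrm{SPR}(\overline R,n,\varepsilon)\le C_D\,\frac{n\log^6 n}{\varepsilon^2}\qquad\text{and}\qquad \mathrm{wSPR}(\overline R,n,\varepsilon)\le C_D\,\frac{n\log^6 n}{\varepsilon^2}.$$ -/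

import Mathlib

namespace CSP

/-- A Mal'tsev operator on `D`: `φ(x,y,y) = φ(y,y,x) = x`. -/
def IsMaltsevOp {D : Type*} (φ : D → D → D → D) : Prop :=
  ∀ x y : D, φ x y y = x ∧ φ y y x = x

/-- `R ⊆ D^r` is a Mal'tsev predicate: it is closed under the coordinatewise action of some
Mal'tsev operator on `D`. -/
def IsMaltsev {D : Type*} {r : ℕ} (R : Set (Fin r → D)) : Prop :=
  ∃ φ : D → D → D → D, IsMaltsevOp φ ∧
    ∀ a ∈ R, ∀ b ∈ R, ∀ c ∈ R, (fun i => φ (a i) (b i) (c i)) ∈ R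

section Weights

variable {D X : Type*} {r : ℕ}

open scoped Classical in
/-- The `R`-weight of the assignment `σ` on the instance with variable set `X` and clause set
`Y ⊆ X^r`: the number of clauses of `Y` that `σ` satisfies. -/
noncomputable def wt (R : Set (Fin r → D)) (Y : Finset (Fin r → X)) (σ : X → D) : ℕ :=
  (Y.filter (fun y => (fun i => σ (y i)) ∈ R)).card

open scoped Classical in
/-- The `(w,R)`-weight of `σ`: the total `w`-weight of the clauses of `Y` that `σ` satisfies. -/
noncomputable def wwt (R : Set (Fin r → D)) (Y : Finset (Fin r → X)) (w : Y → ℝ) (σ : X → D) : ℝ :=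
  ∑ y : Y, w y * (if (fun i => σ (y.1 i)) ∈ R then 1 else 0)

/-- `v : Y → ℝ_{≥0}` is an `ε`-sparsifier of the (unweighted) instance `(X, Y)` of `CSP(R)`. -/
def IsSparsifier (R : Set (Fin r → D)) (Y : Finset (Fin r → X)) (ε : ℝ) (v : Y → ℝ) : Prop :=
  (∀ y, 0 ≤ v y) ∧ ∀ σ : X → D,
    (1 - ε) * (wt R Y σ : ℝ) ≤ wwt R Y v σ ∧ wwt R Y v σ ≤ (1 + ε) * (wt R Y σ : ℝ)

/-- `v : Y → ℝ_{≥0}` is a `(w, ε)`-sparsifier of the weighted instance `(X, Y, w)` of `CSP(R)`. -/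
def IsWeightedSparsifier (R : Set (Fin r → D)) (Y : Finset (Fin r → X)) (w : Y → ℝ) (ε : ℝ)
    (v : Y → ℝ) : Prop :=
  (∀ y, 0 ≤ v y) ∧ ∀ σ : X → D,
    (1 - ε) * wwt R Y w σ ≤ wwt R Y v σ ∧ wwt R Y v σ ≤ (1 + ε) * wwt R Y w σ

/-- The size of the support of a nonnegative weight function on the clauses. -/
noncomputable def suppSize {Y : Finset (Fin r → X)} (v : Y → ℝ) : ℕ :=
  {y : Y | 0 < v y}.ncard

/-- The `ε`-sparsity of an instance: the least support size of an `ε`-sparsifier. -/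
noncomputable def sparsity (R : Set (Fin r → D)) (Y : Finset (Fin r → X)) (ε : ℝ) : ℕ :=
  sInf {k | ∃ v : Y → ℝ, IsSparsifier R Y ε v ∧ suppSize v = k}

/-- The `ε`-sparsity of a weighted instance: the least support size of a `(w, ε)`-sparsifier. -/
noncomputable def weightedSparsity (R : Set (Fin r → D)) (Y : Finset (Fin r → X)) (w : Y → ℝ)
    (ε : ℝ) : ℕ :=
  sInf {k | ∃ v : Y → ℝ, IsWeightedSparsifier R Y w ε v ∧ suppSize v = k}

end Weights

section Predicates

variable {D : Type*} {r : ℕ}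

/-- `SPR(R, n, ε)`: the maximum `ε`-sparsity of an instance of `CSP(R)` on `n` variables
(the variable set is labelled by `Fin n`). -/
noncomputable def SPR (R : Set (Fin r → D)) (n : ℕ) (ε : ℝ) : ℕ :=
  sSup {k | ∃ Y : Finset (Fin r → Fin n), sparsity R Y ε = k}

/-- `wSPR(R, n, ε)`: the maximum `ε`-sparsity of a positively weighted instance of `CSP(R)` on
`n` variables. -/
noncomputable def wSPR (R : Set (Fin r → D)) (n : ℕ) (ε : ℝ) : ℕ :=
  sSup {k | ∃ (Y : Finset (Fin r → Fin n)) (w : Y → ℝ),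
    (∀ y, 0 < w y) ∧ weightedSparsity R Y w ε = k}

end Predicates

/-! The infima and suprema above are over nonempty, respectively bounded, sets of naturals. -/

section WellDefined

variable {D X : Type*} {r : ℕ}

theorem wwt_one (R : Set (Fin r → D)) (Y : Finset (Fin r → X)) (σ : X → D) :
    wwt R Y (fun _ => 1) σ = (wt R Y σ : ℝ) := by
  classical
  unfold wwt wt
  rw [Finset.sum_coe_sort Y (fun y => (1 : ℝ) * (if (fun i => σ (y i)) ∈ R then 1 else 0))]
  simp

theorem wwt_nonneg (R : Set (Fin r → D)) (Y : Finset (Fin r → X)) (w : Y → ℝ)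
    (hw : ∀ y, 0 ≤ w y) (σ : X → D) : 0 ≤ wwt R Y w σ := by
  unfold wwt
  refine Finset.sum_nonneg fun y _ => mul_nonneg (hw y) ?_
  split_ifs <;> norm_num

theorem isWeightedSparsifier_self (R : Set (Fin r → D)) (Y : Finset (Fin r → X)) (w : Y → ℝ)
    (hw : ∀ y, 0 ≤ w y) {ε : ℝ} (hε : 0 ≤ ε) : IsWeightedSparsifier R Y w ε w := by
  refine ⟨hw, fun σ => ?_⟩
  have h := wwt_nonneg R Y w hw σ
  constructor <;> nlinarith

theorem isSparsifier_iff (R : Set (Fin r → D)) (Y : Finset (Fin r → X)) (ε : ℝ) (v : Y → ℝ) :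
    IsSparsifier R Y ε v ↔ IsWeightedSparsifier R Y (fun _ => 1) ε v := by
  simp only [IsSparsifier, IsWeightedSparsifier, wwt_one]

theorem sparsity_eq (R : Set (Fin r → D)) (Y : Finset (Fin r → X)) (ε : ℝ) :
    sparsity R Y ε = weightedSparsity R Y (fun _ => 1) ε := by
  simp only [sparsity, weightedSparsity, isSparsifier_iff]

theorem suppSize_le {Y : Finset (Fin r → X)} (v : Y → ℝ) : suppSize v ≤ Y.card := by
  unfold suppSize
  refine (Set.ncard_le_ncard (Set.subset_univ _)).trans ?_
  simp [Set.ncard_univ]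

theorem weightedSparsity_le (R : Set (Fin r → D)) (Y : Finset (Fin r → X)) (w : Y → ℝ)
    (hw : ∀ y, 0 ≤ w y) {ε : ℝ} (hε : 0 ≤ ε) : weightedSparsity R Y w ε ≤ Y.card :=
  le_trans (b := suppSize w)
    (Nat.sInf_le (s := {k | ∃ v : Y → ℝ, IsWeightedSparsifier R Y w ε v ∧ suppSize v = k})
      ⟨w, isWeightedSparsifier_self R Y w hw hε, rfl⟩) (suppSize_le w)

theorem bddAbove_wSPR (R : Set (Fin r → D)) (n : ℕ) {ε : ℝ} (hε : 0 ≤ ε) :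
    BddAbove {k | ∃ (Y : Finset (Fin r → Fin n)) (w : Y → ℝ),
      (∀ y, 0 < w y) ∧ weightedSparsity R Y w ε = k} := by
  refine ⟨Fintype.card (Fin r → Fin n), ?_⟩
  rintro k ⟨Y, w, hw, rfl⟩
  exact (weightedSparsity_le R Y w (fun y => (hw y).le) hε).trans (Finset.card_le_univ Y)

theorem bddAbove_SPR (R : Set (Fin r → D)) (n : ℕ) {ε : ℝ} (hε : 0 ≤ ε) :
    BddAbove {k | ∃ Y : Finset (Fin r → Fin n), sparsity R Y ε = k} := by
  refine (bddAbove_wSPR R n hε).mono ?_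
  rintro k ⟨Y, rfl⟩
  exact ⟨Y, fun _ => 1, fun _ => one_pos, (sparsity_eq R Y ε).symm⟩

end WellDefined

end CSP

namespace CSP

/-! ### Random sampling: simultaneous exponential tail bounds. -/

section Sampling

open Finset

/-! An assignment is viewed as a word with one coordinate per clause, non-zero where the tuple falls
outside `R`. The words vanishing on a given set of clauses form a flat closed under the Mal'tsev
operator, and such a set is determined, among its supersets, by its forks (`eq_of_forks_subset`).
Counting forks therefore gives a strictly monotone rank bounded by `n |D|^2`, whatever the arity;
this plays the role of dimension for a linear code.

The rest is sparsification in the manner of Benczúr and Karger. A clause set is strong at scale `d`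
if every flat has support of weight at least `d` times its excess rank. Contracting random
coordinates (`Strong.card_inter_le`) shows that words of weight at most `α d` are few, about `exp
(O(α log n))`. Peeling off clauses at dyadic strengths (`exists_levels`) and sampling each at a rate
inversely proportional to its strength keeps `O(K L)` clauses, with `L` the bound on the rank, since
the rank increments telescope. On levels of strength close to the weight of a word, a union bound
over few representatives controls the error; on much weaker levels a union bound over all words
suffices, because the errors decay geometrically.

The counting bound needs light words to be told apart by polynomially many coordinates, yet there
may be `n^r` clauses and the constant must not depend on `r`. At accuracy at most `1/n`,
representatives up to distance `α d / n` are enough and are separated by `O(n^2)` coordinates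
(`hasCovers_of_small`). That leaves polynomially many clauses, so a second round can use exact
representatives (`hasCovers_of_card`). `exists_sparsifier` composes the two rounds. -/

theorem exp_le_one_add_add_sq {x : ℝ} (hx : |x| ≤ 1) : Real.exp x ≤ 1 + x + x ^ 2 := by
  have h := Real.abs_exp_sub_one_sub_id_le hx
  have := (abs_le.mp h).2
  linarith

/-- The exponential moment of a centred, rescaled Bernoulli variable. -/
theorem bernoulli_mgf_le {p g : ℝ} (hp : 0 < p) (hp1 : p ≤ 1) (hg : p < 1 → |g| ≤ p) :
    p * Real.exp (g / p - g) + (1 - p) * Real.exp (-g) ≤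
      Real.exp (if p < 1 then g ^ 2 / p else 0) := by
  split_ifs with h
  · have hg' := hg h
    have ha := abs_le.mp hg'
    have e1 : g / p - g = (1 - p) * (g / p) := by field_simp
    have hgp : |g / p| ≤ 1 := by
      rw [abs_div, abs_of_pos hp]; exact (div_le_one hp).mpr hg'
    have h1 : |g / p - g| ≤ 1 := by
      rw [e1, abs_mul, abs_of_nonneg (by linarith : (0 : ℝ) ≤ 1 - p)]
      exact mul_le_one₀ (by linarith) (abs_nonneg _) hgp
    have h2 : |-g| ≤ 1 := by rw [abs_neg]; linarith
    have b1 := exp_le_one_add_add_sq h1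
    have b2 := exp_le_one_add_add_sq h2
    -- The variable is centred, so the linear terms cancel and only the variance is left.
    have key : p * (1 + (g / p - g) + (g / p - g) ^ 2) + (1 - p) * (1 + (-g) + (-g) ^ 2)
        = 1 + g ^ 2 / p - g ^ 2 := by
      field_simp; ring
    calc _ ≤ p * (1 + (g / p - g) + (g / p - g) ^ 2) + (1 - p) * (1 + (-g) + (-g) ^ 2) :=
          add_le_add (mul_le_mul_of_nonneg_left b1 hp.le)
            (mul_le_mul_of_nonneg_left b2 (by linarith))
      _ ≤ g ^ 2 / p + 1 := by rw [key]; nlinarith [sq_nonneg g]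
      _ ≤ _ := Real.add_one_le_exp _
  · have : p = 1 := le_antisymm hp1 (not_lt.mp h)
    subst this
    simp

open scoped Classical in
/-- Product-measure average of a nonnegative combination of products is attained from below. -/
theorem exists_subset_sum_prod_le {Y E : Type*} (U : Finset Y) (p : Y → ℝ)
    (hp : ∀ y ∈ U, 0 ≤ p y) (hp1 : ∀ y ∈ U, p y ≤ 1) (ev : Finset E) (a : E → ℝ)
    (g h : E → Y → ℝ) :
    ∃ S ⊆ U, ∑ e ∈ ev, a e * ((∏ y ∈ S, g e y) * ∏ y ∈ U \ S, h e y) ≤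
      ∑ e ∈ ev, a e * ∏ y ∈ U, (p y * g e y + (1 - p y) * h e y) := by
  set μ : Finset Y → ℝ := fun S => (∏ y ∈ S, p y) * ∏ y ∈ U \ S, (1 - p y)
  set Ψ : Finset Y → ℝ := fun S => ∑ e ∈ ev, a e * ((∏ y ∈ S, g e y) * ∏ y ∈ U \ S, h e y)
  have hμ : ∀ S ∈ U.powerset, 0 ≤ μ S := fun S hS =>
    mul_nonneg (prod_nonneg fun y hy => hp y (mem_powerset.mp hS hy))
      (prod_nonneg fun y hy => sub_nonneg.mpr (hp1 y (mem_sdiff.mp hy).1))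
  -- Expanding `∏ (p + (1 - p))` over subsets; the same expansion turns the mean of `Ψ` into the
  -- right-hand side, and some subset is at most the mean.
  have hμ1 : ∑ S ∈ U.powerset, μ S = 1 := by
    have := (prod_add p (fun y => 1 - p y) U).symm
    simpa [μ] using this
  have hE : ∑ S ∈ U.powerset, μ S * Ψ S =
      ∑ e ∈ ev, a e * ∏ y ∈ U, (p y * g e y + (1 - p y) * h e y) := by
    simp only [Ψ, mul_sum]
    rw [sum_comm]
    refine sum_congr rfl fun e _ => ?_
    rw [prod_add, mul_sum]
    refine sum_congr rfl fun S _ => ?_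
    simp only [μ, prod_mul_distrib]
    ring
  by_contra hcon
  push Not at hcon
  set T := ∑ e ∈ ev, a e * ∏ y ∈ U, (p y * g e y + (1 - p y) * h e y)
  have hlt : ∑ S ∈ U.powerset, μ S * T < ∑ S ∈ U.powerset, μ S * Ψ S := by
    refine sum_lt_sum (fun S hS => mul_le_mul_of_nonneg_left
      (hcon S (mem_powerset.mp hS)).le (hμ S hS)) ?_
    have : ∃ S ∈ U.powerset, 0 < μ S := by
      by_contra hc
      push Not at hc
      have : ∑ S ∈ U.powerset, μ S ≤ 0 := sum_nonpos hc
      linarith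
    obtain ⟨S, hS, hpos⟩ := this
    exact ⟨S, hS, mul_lt_mul_of_pos_left (hcon S (mem_powerset.mp hS)) hpos⟩
  rw [← sum_mul, hμ1, one_mul, hE] at hlt
  exact lt_irrefl _ hlt

open scoped Classical in
/-- Independent sampling with simultaneous exponential tail bounds and a bound on the size. -/
theorem exists_sample {Y E : Type*} (U : Finset Y) (p : Y → ℝ)
    (hp : ∀ y ∈ U, 0 < p y) (hp1 : ∀ y ∈ U, p y ≤ 1) (ev : Finset E)
    (g : E → Y → ℝ) (B cost : E → ℝ)
    (hg : ∀ e ∈ ev, ∀ y ∈ U, p y < 1 → |g e y| ≤ p y)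
    (hB : ∀ e ∈ ev, ∑ y ∈ U, (if p y < 1 then (g e y) ^ 2 / p y else 0) ≤ B e)
    (hcost : ∑ e ∈ ev, Real.exp (-cost e) ≤ 1 / 8) :
    ∃ S ⊆ U, (S.card : ℝ) ≤ 2 * ∑ y ∈ U, p y + 2 ∧
      ∀ e ∈ ev, |∑ y ∈ S, g e y / p y - ∑ y ∈ U, g e y| ≤ B e + cost e := by
  -- the events: the size, and both signs of every deviation
  set ev' : Finset (Option (E × Bool)) := insertNone (ev ×ˢ univ)
  set s : Bool → ℝ := fun b => if b then 1 else -1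
  -- Each bad event makes its own term at least `1`. The total mean is at most `1/2 + 2 * (1/8) <
  -- 1`, so a single `S` avoids all of them. For the size the test variable is `2 ^ |S|`, of mean at
  -- most `exp (∑ p)`.
  set a : Option (E × Bool) → ℝ := fun o => match o with
    | none => Real.exp (-∑ y ∈ U, p y) / 2
    | some (e, _) => Real.exp (-(B e + cost e))
  set gg : Option (E × Bool) → Y → ℝ := fun o y => match o with
    | none => 2
    | some (e, b) => Real.exp (s b * g e y / p y - s b * g e y)
  set hh : Option (E × Bool) → Y → ℝ := fun o y => match o with
    | none => 1
    | some (e, b) => Real.exp (-(s b * g e y))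
  have hs2 : ∀ b x, (s b * x) ^ 2 = x ^ 2 := by
    intro b x; cases b <;> simp [s]
  have hsabs : ∀ b x, |s b * x| = |x| := by
    intro b x; cases b <;> simp [s]
  obtain ⟨S, hSU, hS⟩ := exists_subset_sum_prod_le U p (fun y hy => (hp y hy).le) hp1 ev' a gg hh
  have hsome : ∀ e ∈ ev, ∀ b, a (some (e, b)) *
      ∏ y ∈ U, (p y * gg (some (e, b)) y + (1 - p y) * hh (some (e, b)) y) ≤
        Real.exp (-cost e) := by
    intro e he b
    have : ∏ y ∈ U, (p y * gg (some (e, b)) y + (1 - p y) * hh (some (e, b)) y) ≤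
        ∏ y ∈ U, Real.exp (if p y < 1 then (g e y) ^ 2 / p y else 0) := by
      refine prod_le_prod (fun y hy => ?_) (fun y hy => ?_)
      · have h1 := hp y hy
        have h2 := hp1 y hy
        have : 0 ≤ 1 - p y := by linarith
        positivity
      · have := bernoulli_mgf_le (g := s b * g e y) (hp y hy) (hp1 y hy)
          (fun h => by rw [hsabs]; exact hg e he y hy h)
        rw [hs2] at this
        exact this
    rw [← Real.exp_sum] at this
    calc _ ≤ Real.exp (-(B e + cost e)) * Real.exp (B e) :=
          mul_le_mul_of_nonneg_left (this.trans (Real.exp_le_exp.mpr (hB e he)))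
            (Real.exp_pos _).le
      _ = _ := by rw [← Real.exp_add]; ring_nf
  have hnone : a none * ∏ y ∈ U, (p y * gg none y + (1 - p y) * hh none y) ≤ 1 / 2 := by
    have : ∏ y ∈ U, (p y * gg none y + (1 - p y) * hh none y) ≤ ∏ y ∈ U, Real.exp (p y) := by
      refine prod_le_prod (fun y hy => ?_) (fun y hy => ?_)
      · have h1 := hp y hy
        simp only [gg, hh]; linarith
      · have := Real.add_one_le_exp (p y)
        simp only [gg, hh]; linarith
    rw [← Real.exp_sum] at this
    calc _ ≤ Real.exp (-∑ y ∈ U, p y) / 2 * Real.exp (∑ y ∈ U, p y) :=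
          mul_le_mul_of_nonneg_left this (by positivity)
      _ = 1 / 2 := by
          rw [div_mul_eq_mul_div, ← Real.exp_add]; simp
  have htot : ∑ o ∈ ev', a o * ∏ y ∈ U, (p y * gg o y + (1 - p y) * hh o y) < 1 := by
    rw [sum_insertNone, sum_product]
    have : ∑ e ∈ ev, ∑ b : Bool, a (some (e, b)) *
        ∏ y ∈ U, (p y * gg (some (e, b)) y + (1 - p y) * hh (some (e, b)) y) ≤
          ∑ e ∈ ev, 2 * Real.exp (-cost e) := by
      refine sum_le_sum fun e he => ?_
      rw [Fintype.sum_bool]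
      linarith [hsome e he true, hsome e he false]
    rw [← mul_sum] at this
    linarith
  have hnn : ∀ o ∈ ev', 0 ≤ a o * ((∏ y ∈ S, gg o y) * ∏ y ∈ U \ S, hh o y) := by
    intro o _
    rcases o with _ | ⟨e, b⟩
    · simp only [a, gg, hh]; positivity
    · simp only [a, gg, hh]; positivity
  have hone : ∀ o ∈ ev', a o * ((∏ y ∈ S, gg o y) * ∏ y ∈ U \ S, hh o y) < 1 := fun o ho =>
    (single_le_sum hnn ho).trans_lt (hS.trans_lt htot)
  have hval : ∀ e ∈ ev, ∀ b,
      s b * (∑ y ∈ S, g e y / p y - ∑ y ∈ U, g e y) ≤ B e + cost e := by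
    intro e he b
    have h := hone (some (e, b)) (by simp [ev', he])
    simp only [a, gg, hh] at h
    rw [← Real.exp_sum, ← Real.exp_sum, ← Real.exp_add, ← Real.exp_add, Real.exp_lt_one_iff] at h
    have e1 : ∑ y ∈ S, (s b * g e y / p y - s b * g e y) + ∑ y ∈ U \ S, -(s b * g e y) =
        s b * (∑ y ∈ S, g e y / p y - ∑ y ∈ U, g e y) := by
      rw [← sum_sdiff hSU, sum_sub_distrib, sum_neg_distrib]
      simp only [mul_sub, mul_add, mul_sum, mul_div_assoc]
      ring
    rw [e1] at h
    linarith
  refine ⟨S, hSU, ?_, fun e he => ?_⟩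
  · have h := hone none (by simp [ev'])
    simp only [a, gg, hh, prod_const, one_pow, mul_one] at h
    have h2 : (2 : ℝ) ^ S.card < 2 * Real.exp (∑ y ∈ U, p y) := by
      rw [Real.exp_neg] at h
      have := Real.exp_pos (∑ y ∈ U, p y)
      field_simp at h
      linarith
    have h3 : Real.log ((2 : ℝ) ^ S.card) < Real.log (2 * Real.exp (∑ y ∈ U, p y)) :=
      Real.log_lt_log (by positivity) h2
    rw [Real.log_pow, Real.log_mul (by norm_num) (Real.exp_pos _).ne', Real.log_exp] at h3
    have l1 := Real.log_two_gt_d9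
    have l2 := Real.log_two_lt_d9
    have : (0 : ℝ) ≤ S.card := by positivity
    nlinarith
  · rw [abs_le]
    have h1 := hval e he true
    have h2 := hval e he false
    simp only [s, if_true, one_mul, Bool.false_eq_true, if_false] at h1 h2
    constructor <;> linarith

end Sampling

end CSP
namespace CSP

/-! ### Flats, strength, and counting light words by contraction. -/

section Flats

set_option linter.unusedSectionVars false

open Finset
open scoped Classical

variable {Ω Y : Type*} [Fintype Ω]

/-- The points of `Ω` on which every coordinate of `S` vanishes. -/
noncomputable def sol (c : Ω → Y → Prop) (S : Finset Y) : Finset Ω :=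
  univ.filter fun σ => ∀ y ∈ S, ¬ c σ y

/-- The coordinates of `Z` that do not vanish identically on `A`. -/
noncomputable def supp (c : Ω → Y → Prop) (Z : Finset Y) (A : Finset Ω) : Finset Y :=
  Z.filter fun y => ∃ σ ∈ A, c σ y

/-- A rank function on the flats `sol c S`: strictly monotone and bounded by `L`. -/
structure IsRank (c : Ω → Y → Prop) (rk : Finset Ω → ℕ) (L : ℕ) : Prop where
  strict : ∀ S T : Finset Y, sol c S ⊂ sol c T → rk (sol c S) < rk (sol c T)
  le : ∀ S : Finset Y, rk (sol c S) ≤ L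

/-- Every flat of `Z` has support of weight at least `d` times its rank over the least flat. -/
def Strong (c : Ω → Y → Prop) (rk : Finset Ω → ℕ) (w : Y → ℝ) (d : ℝ) (Z : Finset Y) : Prop :=
  ∀ S ⊆ Z, d * ((rk (sol c S) : ℝ) - rk (sol c Z)) ≤ ∑ y ∈ supp c Z (sol c S), w y

variable {c : Ω → Y → Prop} {rk : Finset Ω → ℕ} {L : ℕ} {w : Y → ℝ} {d : ℝ} {Z : Finset Y}

theorem mem_sol {S : Finset Y} {σ : Ω} : σ ∈ sol c S ↔ ∀ y ∈ S, ¬ c σ y := by simp [sol]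

theorem mem_supp {A : Finset Ω} {y : Y} : y ∈ supp c Z A ↔ y ∈ Z ∧ ∃ σ ∈ A, c σ y := by
  simp [supp]

theorem sol_anti {S T : Finset Y} (h : S ⊆ T) : sol c T ⊆ sol c S := fun _ hσ =>
  mem_sol.mpr fun y hy => mem_sol.mp hσ y (h hy)

theorem IsRank.mono (hr : IsRank c rk L) {S T : Finset Y} (h : sol c S ⊆ sol c T) :
    rk (sol c S) ≤ rk (sol c T) := by
  rcases h.eq_or_ssubset with h | h
  · rw [h]
  · exact (hr.strict S T h).le

theorem IsRank.insert_lt (hr : IsRank c rk L) {S : Finset Y} {y : Y}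
    (hy : y ∈ supp c Z (sol c S)) : rk (sol c (insert y S)) < rk (sol c S) := by
  obtain ⟨-, σ, hσ, hc⟩ := mem_supp.mp hy
  refine hr.strict _ _ ((ssubset_iff_of_subset (sol_anti (subset_insert _ _))).mpr ⟨σ, hσ, ?_⟩)
  exact fun h => mem_sol.mp h y (mem_insert_self _ _) hc

theorem sol_insert_eq_filter (S : Finset Y) (y : Y) :
    sol c (insert y S) = (sol c S).filter fun σ => ¬ c σ y := by
  ext σ; simp [mem_sol, and_comm]

/-- Restricting to a subset of the coordinates that minimises weight against rank. -/
theorem exists_strong_subset (hr : IsRank c rk L) (hd : 0 ≤ d) (Z : Finset Y) :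
    ∃ Z' ⊆ Z, Strong c rk w d Z' ∧
      ∑ y ∈ Z \ Z', w y ≤ d * ((rk (sol c Z') : ℝ) - rk (sol c Z)) := by
  -- Comparing the minimiser with itself minus the support of a flat gives strength, since that
  -- deletion raises the rank at least to that of the flat; comparing it with `Z` bounds the deleted
  -- weight.
  obtain ⟨Z', hZ', hmin⟩ := exists_min_image Z.powerset
    (fun T => ∑ y ∈ Z \ T, w y - d * (rk (sol c T) : ℝ)) ⟨Z, mem_powerset_self Z⟩
  rw [mem_powerset] at hZ'
  refine ⟨Z', hZ', fun S hS => ?_, ?_⟩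
  · set U := supp c Z' (sol c S)
    have hU : U ⊆ Z' := filter_subset _ _
    have h1 := hmin (Z' \ U) (mem_powerset.mpr (sdiff_subset.trans hZ'))
    have hsub : sol c S ⊆ sol c (Z' \ U) := by
      intro σ hσ
      refine mem_sol.mpr fun y hy hc => ?_
      obtain ⟨hy1, hy2⟩ := mem_sdiff.mp hy
      exact hy2 (mem_supp.mpr ⟨hy1, σ, hσ, hc⟩)
    have h2 : (rk (sol c S) : ℝ) ≤ rk (sol c (Z' \ U)) := by exact_mod_cast hr.mono hsub
    have h3 : ∑ y ∈ Z \ (Z' \ U), w y = ∑ y ∈ Z \ Z', w y + ∑ y ∈ U, w y := by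
      rw [← sum_union]
      · congr 1
        ext y
        simp only [mem_sdiff, mem_union]
        constructor
        · rintro ⟨ha, hb⟩
          by_cases h : y ∈ Z' <;> tauto
        · rintro (⟨ha, hb⟩ | h)
          · tauto
          · exact ⟨hZ' (hU h), by tauto⟩
      · rw [disjoint_left]
        intro y hy hyU
        exact (mem_sdiff.mp hy).2 (hU hyU)
    rw [h3] at h1
    nlinarith
  · have := hmin Z (mem_powerset_self Z)
    rw [Finset.sdiff_self, sum_empty] at this
    linarith

/-- A nonzero word on a strong set of coordinates is heavy. -/
theorem Strong.le_weight (hs : Strong c rk w d Z) (hr : IsRank c rk L) (hd : 0 ≤ d)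
    (hw : ∀ y, 0 ≤ w y) {σ : Ω} {y : Y} (hy : y ∈ Z) (hσ : c σ y) :
    d ≤ ∑ y ∈ Z.filter (c σ), w y := by
  -- The flat cut out by the zeros of `σ` has excess rank at least one, and its support lies inside
  -- that of `σ`.
  set S := Z.filter fun y => ¬ c σ y
  have hS : S ⊆ Z := filter_subset _ _
  have hmem : σ ∈ sol c S := mem_sol.mpr fun y hy => (mem_filter.mp hy).2
  have hlt : rk (sol c Z) < rk (sol c S) := by
    refine hr.strict _ _ ((ssubset_iff_of_subset (sol_anti hS)).mpr ⟨σ, hmem, fun h => ?_⟩)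
    exact mem_sol.mp h y hy hσ
  have h1 : (rk (sol c Z) : ℝ) + 1 ≤ rk (sol c S) := by exact_mod_cast hlt
  have h2 : ∑ y ∈ supp c Z (sol c S), w y ≤ ∑ y ∈ Z.filter (c σ), w y := by
    refine sum_le_sum_of_subset_of_nonneg (fun x hx => ?_) fun _ _ _ => hw _
    obtain ⟨hx1, τ, hτ, hc⟩ := mem_supp.mp hx
    refine mem_filter.mpr ⟨hx1, ?_⟩
    by_contra hn
    exact mem_sol.mp hτ x (mem_filter.mpr ⟨hx1, hn⟩) hc
  have := hs S hS
  nlinarith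

/-- Contraction: few light words survive, hence there are few of them. -/
theorem Strong.card_inter_le (hs : Strong c rk w d Z) (hr : IsRank c rk L) (hd : 0 < d)
    (hw : ∀ y, 0 ≤ w y) {α M : ℝ} (hα : 0 < α) (hM : 0 ≤ M) {P : Finset Ω}
    (hP : ∀ p ∈ P, ∑ y ∈ Z.filter (c p), w y ≤ α * d)
    (hsmall : ∀ S ⊆ Z, ∑ y ∈ supp c Z (sol c S), w y < 2 * α * d →
      ((P ∩ sol c S).card : ℝ) ≤ M) (m : ℕ) :
    ∀ S ⊆ Z, rk (sol c S) - rk (sol c Z) ≤ m →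
      ((P ∩ sol c S).card : ℝ) ≤ M * Real.exp (2 * α * (harmonic m : ℝ)) := by
  induction m with
  | zero =>
    intro S hS hm
    have h0 := hs S hS
    rw [show (harmonic 0 : ℚ) = 0 by simp]
    simp only [Rat.cast_zero, mul_zero, Real.exp_zero, mul_one]
    refine hsmall S hS ?_
    have hE : supp c Z (sol c S) = ∅ := by
      by_contra hne
      obtain ⟨y, hy⟩ := nonempty_iff_ne_empty.mpr hne
      have h1 := hr.insert_lt hy
      have h2 := hr.mono (sol_anti (c := c) (insert_subset (mem_supp.mp hy).1 hS))
      omega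
    rw [hE, sum_empty]; positivity
  | succ m ih =>
    intro S hS hm
    set N := M * Real.exp (2 * α * (harmonic m : ℝ)) with hN
    have hN0 : 0 ≤ N := by positivity
    have hexp : M * Real.exp (2 * α * (harmonic (m + 1) : ℝ)) =
        N * Real.exp (2 * α / (m + 1)) := by
      rw [hN, mul_assoc M, ← Real.exp_add, harmonic_succ]
      congr 2
      push_cast
      field_simp
    rw [hexp]
    have hone : 1 ≤ Real.exp (2 * α / (m + 1)) := Real.one_le_exp (by positivity)
    by_cases hle : rk (sol c S) - rk (sol c Z) ≤ m
    · exact (ih S hS hle).trans (le_mul_of_one_le_right hN0 hone)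
    have hrS : (rk (sol c S) : ℝ) - rk (sol c Z) = m + 1 := by
      have : rk (sol c S) = m + 1 + rk (sol c Z) := by omega
      rw [this]; push_cast; ring
    set U := supp c Z (sol c S) with hU
    set W := ∑ y ∈ U, w y with hW
    rcases lt_or_ge W (2 * α * d) with hlt | hge
    · refine (hsmall S hS hlt).trans ?_
      rw [← hexp]
      refine le_mul_of_one_le_right hM (Real.one_le_exp ?_)
      have : (0 : ℚ) ≤ harmonic (m + 1) := by unfold harmonic; positivity
      have : (0 : ℝ) ≤ (harmonic (m + 1) : ℝ) := by exact_mod_cast this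
      positivity
    have hWpos : 0 < W := lt_of_lt_of_le (by positivity) hge
    have hWr : d * (m + 1) ≤ W := by
      have := hs S hS
      rwa [hrS] at this
    set A := P ∩ sol c S with hA
    -- Contraction as double counting: a coordinate of `U` drawn with probability proportional to
    -- weight is zero on a light word with probability at least `1 - α d / W`, while each contracted
    -- flat has smaller rank and so holds at most `N` words of `P`.
    have hdouble : ∑ y ∈ U, w y * ((A.filter fun σ => ¬ c σ y).card : ℝ) =
        ∑ σ ∈ A, ∑ y ∈ U.filter (fun y => ¬ c σ y), w y := by
      simp only [card_filter, Nat.cast_sum, mul_sum, sum_filter]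
      rw [sum_comm]
      refine sum_congr rfl fun σ _ => sum_congr rfl fun y _ => ?_
      split_ifs <;> simp
    have hlow : (A.card : ℝ) * (W - α * d) ≤
        ∑ σ ∈ A, ∑ y ∈ U.filter (fun y => ¬ c σ y), w y := by
      rw [← nsmul_eq_mul]
      refine card_nsmul_le_sum _ _ _ fun σ hσ => ?_
      have h1 := hP σ (mem_inter.mp hσ).1
      have h2 : ∑ y ∈ U.filter (c σ), w y ≤ ∑ y ∈ Z.filter (c σ), w y :=
        sum_le_sum_of_subset_of_nonneg (filter_subset_filter _ (filter_subset _ _))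
          fun _ _ _ => hw _
      have h3 := sum_filter_add_sum_filter_not U (c σ) w
      linarith
    have hup : ∑ y ∈ U, w y * ((A.filter fun σ => ¬ c σ y).card : ℝ) ≤ W * N := by
      rw [hW, sum_mul]
      refine sum_le_sum fun y hy => mul_le_mul_of_nonneg_left ?_ (hw y)
      have e : A.filter (fun σ => ¬ c σ y) = P ∩ sol c (insert y S) := by
        rw [sol_insert_eq_filter, hA, ← inter_filter]
      rw [e]
      refine ih _ (insert_subset (mem_supp.mp hy).1 hS) ?_
      have := hr.insert_lt hy
      omega
    have hmain : (A.card : ℝ) * (W - α * d) ≤ W * N := hlow.trans (hdouble ▸ hup)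
    -- Heaviness of the support gives `x ≤ 1/2`, hence `1 / (1 - x) ≤ 1 + 2 x`; strength gives `x ≤
    -- α / (m + 1)`. The losses multiply to the exponential of a harmonic sum.
    set x := α * d / W with hx
    have hx0 : 0 ≤ x := by positivity
    have hxW : α * d = x * W := by rw [hx]; field_simp
    have hx2 : x ≤ 1 / 2 := by
      rw [hx, div_le_iff₀ hWpos]; linarith
    have hxm : x ≤ α / (m + 1) := by
      rw [hx, div_le_div_iff₀ hWpos (by positivity)]
      nlinarith
    have h4 : (A.card : ℝ) * (1 - x) ≤ N := by
      have : (A.card : ℝ) * (W - α * d) = W * (A.card * (1 - x)) := by rw [hxW]; ring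
      rw [this] at hmain
      exact le_of_mul_le_mul_left hmain hWpos
    have h5 : (A.card : ℝ) ≤ N * (1 + 2 * x) := by
      have hc0 : (0 : ℝ) ≤ A.card := Nat.cast_nonneg _
      have : (1 : ℝ) ≤ (1 - x) * (1 + 2 * x) := by nlinarith
      calc (A.card : ℝ) ≤ A.card * ((1 - x) * (1 + 2 * x)) := le_mul_of_one_le_right hc0 this
        _ = (A.card * (1 - x)) * (1 + 2 * x) := by ring
        _ ≤ _ := mul_le_mul_of_nonneg_right h4 (by linarith)
    refine h5.trans (mul_le_mul_of_nonneg_left ?_ hN0)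
    calc 1 + 2 * x ≤ 2 * α / (m + 1) + 1 := by
          rw [mul_div_assoc]; linarith
      _ ≤ _ := Real.add_one_le_exp _

/-- The number of traces of a flat on a set of coordinates. -/
theorem card_image_trace_le (hr : IsRank c rk L) {K : Finset Y} (hK : K ⊆ Z) (m : ℕ) :
    ∀ S ⊆ Z, rk (sol c S) - rk (sol c Z) ≤ m →
      ((sol c S).image fun σ => K.filter (c σ)).card ≤ (K.card + 1) ^ m := by
  induction m with
  | zero =>
    intro S hS hm
    rw [pow_zero, card_le_one]
    have hE : ∀ σ ∈ sol c S, K.filter (c σ) = ∅ := by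
      intro σ hσ
      refine filter_eq_empty_iff.mpr fun y hy hc => ?_
      have h1 := hr.insert_lt (mem_supp.mpr ⟨hK hy, σ, hσ, hc⟩)
      have h2 := hr.mono (sol_anti (c := c) (insert_subset (hK hy) hS))
      omega
    intro a ha b hb
    obtain ⟨σ, hσ, rfl⟩ := mem_image.mp ha
    obtain ⟨τ, hτ, rfl⟩ := mem_image.mp hb
    rw [hE σ hσ, hE τ hτ]
  | succ m ih =>
    intro S hS hm
    set f : Ω → Finset Y := fun σ => K.filter (c σ)
    set KS := supp c K (sol c S)
    -- A word is either non-zero on every live coordinate of `K`, which is one trace, or zero on one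
    -- of them and thus in a flat of smaller rank.
    have hsub : (sol c S).image f ⊆
        {KS} ∪ KS.biUnion fun y => (sol c (insert y S)).image f := by
      intro a ha
      obtain ⟨σ, hσ, rfl⟩ := mem_image.mp ha
      by_cases h : ∃ y ∈ KS, ¬ c σ y
      · obtain ⟨y, hy, hc⟩ := h
        refine mem_union_right _ (mem_biUnion.mpr ⟨y, hy, mem_image_of_mem _ ?_⟩)
        rw [sol_insert_eq_filter]
        exact mem_filter.mpr ⟨hσ, hc⟩
      · push Not at h
        refine mem_union_left _ (mem_singleton.mpr ?_)
        ext y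
        simp only [f, mem_filter]
        constructor
        · rintro ⟨h1, h2⟩
          exact mem_supp.mpr ⟨h1, σ, hσ, h2⟩
        · intro hy
          exact ⟨(mem_supp.mp hy).1, h y hy⟩
    have hb : (KS.biUnion fun y => (sol c (insert y S)).image f).card ≤
        KS.card * (K.card + 1) ^ m := by
      refine card_biUnion_le_card_mul _ _ _ fun y hy => ?_
      have hyK := (mem_supp.mp hy).1
      refine ih _ (insert_subset (hK hyK) hS) ?_
      have := hr.insert_lt hy
      omega
    have hKS : KS.card ≤ K.card := card_le_card (filter_subset _ _)
    calc _ ≤ 1 + KS.card * (K.card + 1) ^ m :=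
          (card_le_card hsub).trans ((card_union_le _ _).trans (by
            rw [card_singleton]; exact Nat.add_le_add_left hb 1))
      _ ≤ (K.card + 1) ^ m + K.card * (K.card + 1) ^ m :=
          Nat.add_le_add (Nat.one_le_pow _ _ (Nat.succ_pos _)) (Nat.mul_le_mul_right _ hKS)
      _ = _ := by ring

/-- Greedy separation of words that are pairwise far apart by few coordinates. -/
theorem exists_separating {U : Finset Y} (hw : ∀ y, 0 ≤ w y) {θ : ℝ} (hθ : θ ≤ 1)
    (hUpos : 0 < ∑ y ∈ U, w y) {P : Finset Ω}
    (hfar : ∀ a ∈ P, ∀ b ∈ P, a ≠ b →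
      θ * ∑ y ∈ U, w y ≤ ∑ y ∈ U.filter (fun y => ¬ (c a y ↔ c b y)), w y) (k : ℕ) :
    ∃ K ⊆ U, K.card ≤ k ∧
      (((P ×ˢ P).filter fun x => x.1 ≠ x.2 ∧ ∀ y ∈ K, (c x.1 y ↔ c x.2 y)).card : ℝ) ≤
        (P.card : ℝ) ^ 2 * (1 - θ) ^ k := by
  induction k with
  | zero =>
    refine ⟨∅, empty_subset _, by simp, ?_⟩
    rw [pow_zero, mul_one]
    have := card_filter_le (P ×ˢ P) fun x => x.1 ≠ x.2 ∧ ∀ y ∈ (∅ : Finset Y), (c x.1 y ↔ c x.2 y)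
    rw [card_product] at this
    calc _ ≤ ((P.card * P.card : ℕ) : ℝ) := by exact_mod_cast this
      _ = _ := by push_cast; ring
  | succ k ih =>
    obtain ⟨K, hKU, hKk, hK⟩ := ih
    set Q := (P ×ˢ P).filter fun x => x.1 ≠ x.2 ∧ ∀ y ∈ K, (c x.1 y ↔ c x.2 y)
    set W := ∑ y ∈ U, w y with hW
    -- A weighted random coordinate fails to separate a given pair with probability at most `1 - θ`,
    -- so some coordinate leaves at most that fraction of the pairs.
    have hsum : ∑ y ∈ U, w y * ((Q.filter fun x => (c x.1 y ↔ c x.2 y)).card : ℝ) ≤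
        ∑ y ∈ U, w y * ((Q.card : ℝ) * (1 - θ)) := by
      have e : ∑ y ∈ U, w y * ((Q.filter fun x => (c x.1 y ↔ c x.2 y)).card : ℝ) =
          ∑ x ∈ Q, ∑ y ∈ U.filter (fun y => (c x.1 y ↔ c x.2 y)), w y := by
        simp only [card_filter, Nat.cast_sum, mul_sum, sum_filter]
        rw [sum_comm]
        refine sum_congr rfl fun σ _ => sum_congr rfl fun y _ => ?_
        split_ifs <;> simp
      rw [e, ← sum_mul, ← hW]
      have : ∑ x ∈ Q, ∑ y ∈ U.filter (fun y => (c x.1 y ↔ c x.2 y)), w y ≤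
          Q.card • (W * (1 - θ)) := by
        refine sum_le_card_nsmul _ _ _ fun x hx => ?_
        obtain ⟨hx1, hx2, -⟩ := mem_filter.mp hx
        obtain ⟨ha, hb⟩ := mem_product.mp hx1
        have h1 := hfar x.1 ha x.2 hb hx2
        have h2 := sum_filter_add_sum_filter_not U (fun y => (c x.1 y ↔ c x.2 y)) w
        linarith
      rw [nsmul_eq_mul] at this
      linarith
    have : ∃ y ∈ U, ((Q.filter fun x => (c x.1 y ↔ c x.2 y)).card : ℝ) ≤ Q.card * (1 - θ) := by
      by_contra hcon
      push Not at hcon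
      have hpos : ∃ y ∈ U, 0 < w y := by
        by_contra hc
        push Not at hc
        exact absurd (sum_nonpos hc) (not_le.mpr hUpos)
      obtain ⟨y0, hy0, hwy0⟩ := hpos
      refine absurd hsum (not_le.mpr (sum_lt_sum
        (fun y hy => mul_le_mul_of_nonneg_left (hcon y hy).le (hw y)) ⟨y0, hy0, ?_⟩))
      exact mul_lt_mul_of_pos_left (hcon y0 hy0) hwy0
    obtain ⟨y, hyU, hy⟩ := this
    refine ⟨insert y K, insert_subset hyU hKU, (card_insert_le _ _).trans (by omega), ?_⟩
    have e : (P ×ˢ P).filter (fun x => x.1 ≠ x.2 ∧ ∀ z ∈ insert y K, (c x.1 z ↔ c x.2 z)) =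
        Q.filter fun x => (c x.1 y ↔ c x.2 y) := by
      ext x
      simp only [Q, mem_filter, mem_insert, forall_eq_or_imp]
      tauto
    rw [e]
    calc _ ≤ (Q.card : ℝ) * (1 - θ) := hy
      _ ≤ _ := by
        rw [pow_succ (1 - θ), ← mul_assoc]
        exact mul_le_mul_of_nonneg_right hK (by linarith)

/-- A maximal set of pairwise unrelated elements dominates. -/
theorem exists_maximal_unrelated {α : Type*} (Q : Finset α) (C : α → α → Prop)
    (hrefl : ∀ a, C a a) (hsymm : ∀ a b, C a b → C b a) :
    ∃ P ⊆ Q, (∀ a ∈ P, ∀ b ∈ P, a ≠ b → ¬ C a b) ∧ ∀ a ∈ Q, ∃ b ∈ P, C a b := by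
  obtain ⟨good, hgood⟩ : ∃ good : Finset α → Prop,
      ∀ P, good P ↔ ∀ a ∈ P, ∀ b ∈ P, a ≠ b → ¬ C a b := ⟨_, fun _ => Iff.rfl⟩
  obtain ⟨P, hP, hmax⟩ := exists_max_image (Q.powerset.filter good) card
    ⟨∅, by simp [hgood]⟩
  obtain ⟨hPQ, hPC⟩ := mem_filter.mp hP
  rw [mem_powerset] at hPQ
  rw [hgood] at hPC
  refine ⟨P, hPQ, hPC, fun a ha => ?_⟩
  by_contra hcon
  push Not at hcon
  have haP : a ∉ P := fun h => hcon a h (hrefl a)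
  have := hmax (insert a P) (mem_filter.mpr
    ⟨mem_powerset.mpr (insert_subset ha hPQ), (hgood _).mpr ?_⟩)
  · rw [card_insert_of_notMem haP] at this
    omega
  · intro x hx y hy hxy
    rcases mem_insert.mp hx with rfl | hx' <;> rcases mem_insert.mp hy with rfl | hy'
    · exact absurd rfl hxy
    · exact hcon y hy'
    · exact fun h => hcon x hx' (hsymm _ _ h)
    · exact hPC x hx' y hy' hxy

end Flats

end CSP
namespace CSP

/-! ### Small families of representatives for light words. -/

section Covers

set_option linter.unusedSectionVars false

open Finset
open scoped Classical

variable {Ω Y : Type*} [Fintype Ω] {c : Ω → Y → Prop} {rk : Finset Ω → ℕ} {L : ℕ} {w : Y → ℝ}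
  {d : ℝ} {Z : Finset Y}

/-- If the light words of a family are told apart by few coordinates on every light flat, the
family is small. -/
theorem Strong.card_le_exp (hs : Strong c rk w d Z) (hr : IsRank c rk L) (hd : 0 < d)
    (hw : ∀ y, 0 ≤ w y) {α κ H ℓ : ℝ} (hα : 0 < α) (hκ : 0 ≤ κ) (hℓ : 0 ≤ ℓ)
    (hL : 1 + Real.log L ≤ H * ℓ) {P : Finset Ω}
    (hP : ∀ p ∈ P, ∑ y ∈ Z.filter (c p), w y ≤ α * d)
    (hsep : ∀ S ⊆ Z, ∑ y ∈ supp c Z (sol c S), w y < 2 * α * d →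
      ∃ K ⊆ Z, (K.card : ℝ) + 1 ≤ Real.exp (κ * ℓ) ∧
        ∀ a ∈ P ∩ sol c S, ∀ b ∈ P ∩ sol c S, (∀ y ∈ K, (c a y ↔ c b y)) → a = b) :
    (P.card : ℝ) ≤ Real.exp ((2 * κ + 2 * H) * α * ℓ) := by
  have hsmall : ∀ S ⊆ Z, ∑ y ∈ supp c Z (sol c S), w y < 2 * α * d →
      ((P ∩ sol c S).card : ℝ) ≤ Real.exp (κ * ℓ * (2 * α)) := by
    intro S hS hlt
    obtain ⟨K, hK, hcard, hinj⟩ := hsep S hS hlt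
    set r := rk (sol c S) - rk (sol c Z) with hr'
    have hmono := hr.mono (sol_anti (c := c) hS)
    -- Strength forces a flat of small support to have small excess rank, so its traces on `K`
    -- number at most `(|K| + 1) ^ (2 α)`.
    have hrα : (r : ℝ) ≤ 2 * α := by
      have h1 := hs S hS
      have h2 : (r : ℝ) = (rk (sol c S) : ℝ) - rk (sol c Z) := by
        rw [hr', Nat.cast_sub hmono]
      rw [← h2] at h1
      nlinarith
    have h1 : (P ∩ sol c S).card ≤ (K.card + 1) ^ r := by
      refine le_trans ?_ (card_image_trace_le hr hK r S hS le_rfl)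
      rw [← card_image_of_injOn (s := P ∩ sol c S) (f := fun σ => K.filter (c σ))]
      · exact card_le_card (image_subset_image inter_subset_right)
      · intro a ha b hb hab
        refine hinj a ha b hb fun y hy => ?_
        have := congrArg (fun s => y ∈ s) hab
        simpa [hy] using this
    calc ((P ∩ sol c S).card : ℝ) ≤ ((K.card : ℝ) + 1) ^ r := by exact_mod_cast h1
      _ ≤ Real.exp (κ * ℓ) ^ r := pow_le_pow_left₀ (by positivity) hcard _
      _ = Real.exp (κ * ℓ * r) := by rw [← Real.exp_nat_mul]; ring_nf
      _ ≤ _ := Real.exp_le_exp.mpr (mul_le_mul_of_nonneg_left hrα (by positivity))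
  have h := hs.card_inter_le hr hd hw hα (Real.exp_pos _).le hP hsmall L ∅ (empty_subset _)
    ((Nat.sub_le _ _).trans (hr.le _))
  have hu : P ∩ sol c ∅ = P := by
    rw [inter_eq_left]; intro σ _; simp [mem_sol]
  rw [hu, ← Real.exp_add] at h
  refine h.trans (Real.exp_le_exp.mpr ?_)
  have h2 := harmonic_le_one_add_log L
  have : 2 * α * (harmonic L : ℝ) ≤ 2 * α * (H * ℓ) :=
    mul_le_mul_of_nonneg_left (h2.trans hL) (by positivity)
  linarith

/-- Representatives of the light words up to a small distance, or exactly. -/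
def HasCovers (c : Ω → Y → Prop) (rk : Finset Ω → ℕ) (w : Y → ℝ) (Z₀ : Finset Y)
    (C ℓ : ℝ) (n : ℕ) (ε : ℝ) : Prop :=
  ∀ d > 0, ∀ Z ⊆ Z₀, Strong c rk w d Z → ∀ α > 0, ∃ P : Finset Ω,
    (∀ p ∈ P, ∑ y ∈ Z.filter (c p), w y ≤ α * d) ∧ (P.card : ℝ) ≤ Real.exp (C * α * ℓ) ∧
    ∀ σ, ∑ y ∈ Z.filter (c σ), w y ≤ α * d → ∃ p ∈ P,
      ∑ y ∈ Z.filter (fun y => ¬ (c σ y ↔ c p y)), w y ≤ α * d / n ∧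
        ((∀ y ∈ Z, (c σ y ↔ c p y)) ∨ ε * n ≤ 1)

/-- With few coordinates one word per trace on `Z` can be kept: `Z` itself separates them, and no
approximation is lost. -/
theorem hasCovers_of_card (hr : IsRank c rk L) (hw : ∀ y, 0 ≤ w y) {κ H ℓ : ℝ} (hκ : 0 ≤ κ)
    (hℓ : 0 ≤ ℓ) (hL : 1 + Real.log L ≤ H * ℓ) {Z₀ : Finset Y}
    (hZ₀ : (Z₀.card : ℝ) + 1 ≤ Real.exp (κ * ℓ)) (n : ℕ) (ε : ℝ) :
    HasCovers c rk w Z₀ (2 * κ + 2 * H) ℓ n ε := by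
  intro d hd Z hZ hs α hα
  obtain ⟨P, hPQ, hPC, hcov⟩ := exists_maximal_unrelated
    ((univ : Finset Ω).filter fun σ => ∑ y ∈ Z.filter (c σ), w y ≤ α * d)
    (fun σ τ => ∀ y ∈ Z, (c σ y ↔ c τ y)) (fun _ _ _ => Iff.rfl)
    (fun _ _ h y hy => (h y hy).symm)
  have hP : ∀ p ∈ P, ∑ y ∈ Z.filter (c p), w y ≤ α * d := fun p hp => (mem_filter.mp (hPQ hp)).2
  refine ⟨P, hP, hs.card_le_exp hr hd hw hα hκ hℓ hL hP fun S hS _ =>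
    ⟨Z, Subset.rfl, le_trans ?_ hZ₀, fun a ha b hb hab => ?_⟩, fun σ hσ => ?_⟩
  · have := card_le_card hZ
    have : (Z.card : ℝ) ≤ Z₀.card := by exact_mod_cast this
    linarith
  · by_contra hne
    exact hPC a (mem_inter.mp ha).1 b (mem_inter.mp hb).1 hne hab
  · obtain ⟨p, hp, hσp⟩ := hcov σ (mem_filter.mpr ⟨mem_univ _, hσ⟩)
    refine ⟨p, hp, ?_, Or.inl hσp⟩
    rw [filter_eq_empty_iff.mpr fun y hy h => h (hσp y hy), sum_empty]
    positivity

/-- No bound on the size of `Z₀` is needed. Representatives at pairwise distance above `α d / n`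
differ, on a flat of support below `2 α d`, on more than a `1 / (2 n)` fraction of the support, so
`O(q n^2)` greedily chosen coordinates separate them. -/
theorem hasCovers_of_small (hr : IsRank c rk L) (hw : ∀ y, 0 ≤ w y) {q n : ℕ} {H ℓ ε : ℝ}
    (hq : 1 ≤ q) (hn : 1 ≤ n) (hΩ : (Fintype.card Ω : ℝ) ≤ Real.exp (q * n))
    (hℓ : 1 ≤ ℓ) (hnℓ : (n : ℝ) ≤ Real.exp ℓ)
    (hL : 1 + Real.log L ≤ H * ℓ) (hε : ε * n ≤ 1) (Z₀ : Finset Y) :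
    HasCovers c rk w Z₀ (2 * (q + 4) + 2 * H) ℓ n ε := by
  intro d hd Z hZ hs α hα
  have hn' : (1 : ℝ) ≤ n := by exact_mod_cast hn
  have hq' : (1 : ℝ) ≤ q := by exact_mod_cast hq
  have hn0 : (0 : ℝ) < n := by linarith
  set D : Ω → Ω → ℝ := fun σ τ => ∑ y ∈ Z.filter (fun y => ¬ (c σ y ↔ c τ y)), w y with hD
  obtain ⟨P, hPQ, hPC, hcov⟩ := exists_maximal_unrelated
    ((univ : Finset Ω).filter fun σ => ∑ y ∈ Z.filter (c σ), w y ≤ α * d)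
    (fun σ τ => D σ τ ≤ α * d / n) (fun σ => by simp only [hD]; simp; positivity)
    (fun σ τ h => by
      have : D τ σ = D σ τ := by
        simp only [hD]; congr 1; ext y; simp only [mem_filter]; tauto
      rw [this]; exact h)
  have hP : ∀ p ∈ P, ∑ y ∈ Z.filter (c p), w y ≤ α * d := fun p hp => (mem_filter.mp (hPQ hp)).2
  refine ⟨P, hP, ?_, fun σ hσ => ?_⟩
  · refine hs.card_le_exp hr hd hw hα (by positivity) (by linarith) hL hP fun S hS hlt => ?_
    set U := supp c Z (sol c S) with hU
    set A := P ∩ sol c S with hA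
    have hDU : ∀ a ∈ A, ∀ b ∈ A,
        D a b = ∑ y ∈ U.filter (fun y => ¬ (c a y ↔ c b y)), w y := by
      intro a ha b hb
      simp only [hD]
      congr 1
      ext y
      simp only [mem_filter, hU, mem_supp]
      constructor
      · rintro ⟨h1, h2⟩
        refine ⟨⟨h1, ?_⟩, h2⟩
        by_cases h : c a y
        · exact ⟨a, (mem_inter.mp ha).2, h⟩
        · exact ⟨b, (mem_inter.mp hb).2, by tauto⟩
      · rintro ⟨⟨h1, -⟩, h2⟩
        exact ⟨h1, h2⟩
    have hfar : ∀ a ∈ A, ∀ b ∈ A, a ≠ b → α * d / n < D a b := fun a ha b hb hab =>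
      not_le.mp (hPC a (mem_inter.mp ha).1 b (mem_inter.mp hb).1 hab)
    have hαd : 0 < α * d / n := by positivity
    have hUle : ∀ a ∈ A, ∀ b ∈ A, D a b ≤ ∑ y ∈ U, w y := by
      intro a ha b hb
      rw [hDU a ha b hb]
      exact sum_le_sum_of_subset_of_nonneg (filter_subset _ _) fun _ _ _ => hw _
    have hexp : 6 * (q : ℝ) * n ^ 2 ≤ Real.exp ((q + 4) * ℓ) := by
      have e1 : (6 : ℝ) ≤ Real.exp 2 := by
        have h1 := Real.exp_one_gt_d9
        have : Real.exp 2 = Real.exp 1 * Real.exp 1 := by rw [← Real.exp_add]; norm_num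
        rw [this]; nlinarith
      have e2 : (q : ℝ) ≤ Real.exp q := by linarith [Real.add_one_le_exp (q : ℝ)]
      calc 6 * (q : ℝ) * n ^ 2 ≤ Real.exp 2 * Real.exp q * Real.exp ℓ ^ 2 := by gcongr
        _ = Real.exp (2 + q + 2 * ℓ) := by
          rw [← Real.exp_nat_mul, ← Real.exp_add, ← Real.exp_add]; norm_num
        _ ≤ _ := Real.exp_le_exp.mpr (by nlinarith)
    rcases (sum_nonneg fun y (_ : y ∈ U) => hw y).eq_or_lt with h0 | hpos
    · refine ⟨∅, empty_subset _, ?_, fun a ha b hb _ => ?_⟩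
      · simp only [card_empty, Nat.cast_zero, zero_add]
        exact Real.one_le_exp (by positivity)
      · by_contra hne
        have h1 := hfar a ha b hb hne
        have h2 := hUle a ha b hb
        linarith
    · have hθ : (1 / (2 * n) : ℝ) ≤ 1 := by
        rw [div_le_one (by positivity)]; linarith
      -- There are at most `exp (2 q n)` pairs, and `4 q n^2 + 1` steps shrink them by `exp (-(2 q n
      -- + 1 / (2 n)))`, leaving fewer than one.
      obtain ⟨K, hKU, hKk, hK⟩ := exists_separating (c := c) (P := A) hw hθ hpos
        (fun a ha b hb hab => by
          rw [← hDU a ha b hb]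
          refine le_trans ?_ (hfar a ha b hb hab).le
          rw [div_mul_eq_mul_div, div_le_div_iff₀ (by positivity) hn0]
          nlinarith) (4 * q * n ^ 2 + 1)
      refine ⟨K, hKU.trans (filter_subset _ _), ?_, fun a ha b hb hab => ?_⟩
      · refine le_trans ?_ hexp
        have : (K.card : ℝ) ≤ 4 * q * n ^ 2 + 1 := by exact_mod_cast hKk
        have : (1 : ℝ) ≤ q * n ^ 2 := one_le_mul_of_one_le_of_one_le hq' (one_le_pow₀ hn')
        linarith
      · by_contra hne
        have hmem : (a, b) ∈ (A ×ˢ A).filter fun x => x.1 ≠ x.2 ∧ ∀ y ∈ K, (c x.1 y ↔ c x.2 y) :=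
          mem_filter.mpr ⟨mem_product.mpr ⟨ha, hb⟩, hne, hab⟩
        have h1 : (1 : ℝ) ≤ (((A ×ˢ A).filter fun x => x.1 ≠ x.2 ∧
            ∀ y ∈ K, (c x.1 y ↔ c x.2 y)).card : ℝ) := by
          exact_mod_cast card_pos.mpr ⟨_, hmem⟩
        have hAc : (A.card : ℝ) ≤ Real.exp (q * n) :=
          le_trans (by exact_mod_cast card_le_univ A) hΩ
        have h2 : (1 - 1 / (2 * n) : ℝ) ^ (4 * q * n ^ 2 + 1) ≤
            Real.exp (-(1 / (2 * n))) ^ (4 * q * n ^ 2 + 1) :=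
          pow_le_pow_left₀ (by linarith) (by linarith [Real.add_one_le_exp (-(1 / (2 * n) : ℝ))]) _
        have h3 : (A.card : ℝ) ^ 2 * (1 - 1 / (2 * n) : ℝ) ^ (4 * q * n ^ 2 + 1) < 1 := by
          calc _ ≤ Real.exp (q * n) ^ 2 * Real.exp (-(1 / (2 * n))) ^ (4 * q * n ^ 2 + 1) := by
                have : (0 : ℝ) ≤ 1 - 1 / (2 * n) := by linarith
                gcongr
            _ = Real.exp (-(1 / (2 * n))) := by
                rw [← Real.exp_nat_mul, ← Real.exp_nat_mul, ← Real.exp_add]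
                congr 1
                push_cast
                field_simp
                ring
            _ < 1 := by
                rw [Real.exp_lt_one_iff]
                have : (0 : ℝ) < 1 / (2 * n) := by positivity
                linarith
        linarith [hK]
  · obtain ⟨p, hp, hσp⟩ := hcov σ (mem_filter.mpr ⟨mem_univ _, hσ⟩)
    exact ⟨p, hp, hσp, Or.inr hε⟩

end Covers

end CSP
namespace CSP

/-! ### Strength levels and importance sampling. -/

section Levels

set_option linter.unusedSectionVars false

open Finset
open scoped Classical

variable {Ω Y : Type*} [Fintype Ω] {c : Ω → Y → Prop} {rk : Finset Ω → ℕ} {L : ℕ} {w : Y → ℝ}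

/-- Decomposition of the coordinates into dyadic levels of strength. -/
theorem exists_levels (hr : IsRank c rk L) (hw : ∀ y, 0 ≤ w y) {Z₀ : Finset Y}
    (hZ₀ : ∀ y ∈ Z₀, 0 < w y) :
    ∃ (T : ℕ) (d₀ : ℝ) (Z : ℕ → Finset Y), 0 < d₀ ∧ Z 0 = Z₀ ∧ Antitone Z ∧
      (∀ i, Strong c rk w (d₀ * 2 ^ i) (Z i)) ∧ (∀ σ, ∀ y ∈ Z T, ¬ c σ y) ∧
      ∑ i ∈ range T, (∑ y ∈ Z i \ Z (i + 1), w y) / (d₀ * 2 ^ i) ≤ 2 * L ∧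
      ((range T).filter fun i => (Z i \ Z (i + 1)).Nonempty).card ≤ L := by
  -- At this scale one live coordinate already outweighs the maximal rank, so `Z₀` is strong without
  -- any deletion.
  obtain ⟨d₀, hd₀, hmin⟩ : ∃ d₀ : ℝ, 0 < d₀ ∧ ∀ y ∈ Z₀, d₀ * (L + 1) ≤ w y := by
    rcases Z₀.eq_empty_or_nonempty with rfl | hne
    · exact ⟨1, one_pos, by simp⟩
    · obtain ⟨y₀, hy₀, hm⟩ := exists_min_image Z₀ w hne
      refine ⟨w y₀ / (L + 1), div_pos (hZ₀ y₀ hy₀) (by positivity), fun y hy => ?_⟩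
      rw [div_mul_cancel₀ _ (by positivity)]
      exact hm y hy
  have hd : ∀ i : ℕ, 0 < d₀ * 2 ^ i := fun i => by positivity
  choose f hf1 hf2 hf3 using fun (i : ℕ) (Z : Finset Y) =>
    exists_strong_subset (w := w) hr (hd (i + 1)).le Z
  set Z : ℕ → Finset Y := fun i => Nat.rec Z₀ (fun j A => f j A) i with hZ
  have hZs : ∀ i, Z (i + 1) = f i (Z i) := fun i => rfl
  have hanti : Antitone Z := antitone_nat_of_succ_le fun i => hf1 i (Z i)
  have hsub : ∀ i, Z i ⊆ Z₀ := fun i => hanti (Nat.zero_le i)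
  have hstrong : ∀ i, Strong c rk w (d₀ * 2 ^ i) (Z i) := by
    intro i
    rcases i with _ | i
    · intro S hS
      rw [pow_zero, mul_one]
      have hn : 0 ≤ ∑ y ∈ supp c Z₀ (sol c S), w y := sum_nonneg fun y _ => hw y
      rcases (supp c Z₀ (sol c S)).eq_empty_or_nonempty with h0 | ⟨y, hy⟩
      · have hle : sol c S ⊆ sol c Z₀ := by
          intro σ hσ
          refine mem_sol.mpr fun y hy hc => ?_
          have : y ∈ supp c Z₀ (sol c S) := mem_supp.mpr ⟨hy, σ, hσ, hc⟩
          rw [h0] at this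
          exact absurd this (notMem_empty _)
        have : (rk (sol c S) : ℝ) ≤ rk (sol c Z₀) := by exact_mod_cast hr.mono hle
        change d₀ * ((rk (sol c S) : ℝ) - rk (sol c Z₀)) ≤ ∑ y ∈ supp c Z₀ (sol c S), w y
        nlinarith
      · have h1 := hmin y (mem_supp.mp hy).1
        have h2 := single_le_sum (fun y _ => hw y) hy
        have h3 : (rk (sol c S) : ℝ) ≤ L := by exact_mod_cast hr.le S
        have h4 : (0 : ℝ) ≤ rk (sol c Z₀) := Nat.cast_nonneg _
        change d₀ * ((rk (sol c S) : ℝ) - rk (sol c Z₀)) ≤ ∑ y ∈ supp c Z₀ (sol c S), w y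
        nlinarith
    · exact hf2 i (Z i)
  have hdrop : ∀ i, ∑ y ∈ Z i \ Z (i + 1), w y ≤
      d₀ * 2 ^ (i + 1) * ((rk (sol c (Z (i + 1))) : ℝ) - rk (sol c (Z i))) := fun i => hf3 i (Z i)
  have hdrop0 : ∀ i, (0 : ℝ) ≤ (rk (sol c (Z (i + 1))) : ℝ) - rk (sol c (Z i)) := fun i => by
    have : (rk (sol c (Z i)) : ℝ) ≤ rk (sol c (Z (i + 1))) := by
      exact_mod_cast hr.mono (sol_anti (hanti (Nat.le_succ i)))
    linarith
  -- Once the strength exceeds the total weight, no word can be non-zero on the remaining set.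
  obtain ⟨T, hT⟩ := pow_unbounded_of_one_lt ((∑ y ∈ Z₀, w y) / d₀) (one_lt_two (α := ℝ))
  rw [div_lt_iff₀ hd₀] at hT
  -- This telescoping pays for both the normalised weight of the levels and the number of non-empty
  -- ones.
  have htel : ∑ i ∈ range T, ((rk (sol c (Z (i + 1))) : ℝ) - rk (sol c (Z i))) ≤ L := by
    rw [sum_range_sub fun i => (rk (sol c (Z i)) : ℝ)]
    have h1 : (rk (sol c (Z T)) : ℝ) ≤ L := by exact_mod_cast hr.le _
    have h2 : (0 : ℝ) ≤ rk (sol c (Z 0)) := Nat.cast_nonneg _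
    linarith
  refine ⟨T, d₀, Z, hd₀, rfl, hanti, hstrong, fun σ y hy hc => ?_, ?_, ?_⟩
  · have h1 := (hstrong T).le_weight hr (hd T).le hw hy hc
    have h2 : ∑ y ∈ (Z T).filter (c σ), w y ≤ ∑ y ∈ Z₀, w y :=
      sum_le_sum_of_subset_of_nonneg ((filter_subset _ _).trans (hsub T)) fun _ _ _ => hw _
    linarith
  · calc _ ≤ ∑ i ∈ range T, 2 * ((rk (sol c (Z (i + 1))) : ℝ) - rk (sol c (Z i))) := by
          refine sum_le_sum fun i _ => ?_
          rw [div_le_iff₀ (hd i)]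
          refine (hdrop i).trans (le_of_eq ?_)
          ring
      _ ≤ _ := by rw [← mul_sum]; linarith
  · have : (((range T).filter fun i => (Z i \ Z (i + 1)).Nonempty).card : ℝ) ≤ L := by
      refine le_trans ?_ htel
      rw [card_filter, Nat.cast_sum]
      refine sum_le_sum fun i _ => ?_
      split_ifs with hne
      · obtain ⟨y, hy⟩ := hne
        have h1 := hZ₀ y (hsub i (mem_sdiff.mp hy).1)
        have h2 := single_le_sum (fun y _ => hw y) hy
        have h3 : 0 < d₀ * 2 ^ (i + 1) *
            ((rk (sol c (Z (i + 1))) : ℝ) - rk (sol c (Z i))) := by linarith [hdrop i]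
        have h4 := (pos_iff_pos_of_mul_pos h3).mp (hd _)
        have h5 : rk (sol c (Z i)) + 1 ≤ rk (sol c (Z (i + 1))) := by
          have : (rk (sol c (Z i)) : ℝ) < rk (sol c (Z (i + 1))) := by linarith
          exact_mod_cast this
        have : (rk (sol c (Z i)) : ℝ) + 1 ≤ rk (sol c (Z (i + 1))) := by exact_mod_cast h5
        push_cast
        linarith
      · simpa using hdrop0 i
    exact_mod_cast this

/-- Importance sampling with respect to a scale `dd`, with deviations controlled for test functions
that live on one scale. -/
theorem exists_scaled_sample {E : Type*} (U : Finset Y) (w dd : Y → ℝ) {K : ℝ} (hK : 0 < K)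
    (hw : ∀ y ∈ U, 0 < w y) (hdd : ∀ y ∈ U, 0 < dd y) (ev : Finset E)
    (f : E → Y → ℝ) (d lam V cost : E → ℝ) (hlam : ∀ e ∈ ev, 0 < lam e) (hd : ∀ e ∈ ev, 0 < d e)
    (hf1 : ∀ e ∈ ev, ∀ y ∈ U, |f e y| ≤ 1)
    (hfd : ∀ e ∈ ev, ∀ y ∈ U, f e y ≠ 0 → dd y = d e ∧ lam e * d e ≤ K)
    (hV : ∀ e ∈ ev, ∑ y ∈ U, w y * |f e y| ≤ V e)
    (hcost : ∑ e ∈ ev, Real.exp (-cost e) ≤ 1 / 8) :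
    ∃ S ⊆ U, (S.card : ℝ) ≤ 2 * (K * ∑ y ∈ U, w y / dd y) + 2 ∧
      ∀ e ∈ ev, |∑ y ∈ S, w y * f e y / min 1 (K * w y / dd y) - ∑ y ∈ U, w y * f e y| ≤
        lam e * d e * V e / K + cost e / lam e := by
  -- A coordinate capped at `1` is kept surely and contributes no deviation; below the cap `(w f)^2
  -- / p = (d / K) w f^2`, so the variance is linear in the weight of the test function.
  set p : Y → ℝ := fun y => min 1 (K * w y / dd y) with hp
  have hp0 : ∀ y ∈ U, 0 < p y := fun y hy =>
    lt_min one_pos (div_pos (mul_pos hK (hw y hy)) (hdd y hy))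
  have hp1 : ∀ y ∈ U, p y ≤ 1 := fun y _ => min_le_left _ _
  have hpe : ∀ y, p y < 1 → p y = K * w y / dd y := fun y h => by
    rcases min_choice (1 : ℝ) (K * w y / dd y) with h1 | h1
    · exact absurd h1 h.ne
    · exact h1
  have hga : ∀ e ∈ ev, ∀ y ∈ U, p y < 1 → |lam e * (w y * f e y)| ≤ p y := by
    intro e he y hy h
    rw [hpe y h, abs_mul, abs_mul, abs_of_pos (hlam e he), abs_of_pos (hw y hy)]
    rcases eq_or_ne (f e y) 0 with h0 | h0
    · rw [h0, abs_zero, mul_zero, mul_zero]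
      exact (div_pos (mul_pos hK (hw y hy)) (hdd y hy)).le
    · obtain ⟨h1, h2⟩ := hfd e he y hy h0
      rw [h1, le_div_iff₀ (hd e he)]
      have h3 := hf1 e he y hy
      have h4 := hw y hy
      have h5 := hlam e he
      have h6 := hd e he
      calc lam e * (w y * |f e y|) * d e ≤ lam e * (w y * 1) * d e := by gcongr
        _ = lam e * d e * w y := by ring
        _ ≤ _ := mul_le_mul_of_nonneg_right h2 h4.le
  have hgb : ∀ e ∈ ev, ∑ y ∈ U, (if p y < 1 then (lam e * (w y * f e y)) ^ 2 / p y else 0) ≤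
      lam e ^ 2 * (d e * V e / K) := by
    intro e he
    have hdK : 0 ≤ lam e ^ 2 * (d e / K) := by have := hd e he; positivity
    calc _ ≤ ∑ y ∈ U, lam e ^ 2 * (d e / K) * (w y * |f e y|) := by
          refine sum_le_sum fun y hy => ?_
          have h4 := hw y hy
          split_ifs with h
          · rcases eq_or_ne (f e y) 0 with h0 | h0
            · simp [h0]
            · obtain ⟨h1, -⟩ := hfd e he y hy h0
              have h6 := hd e he
              rw [hpe y h, h1]
              have h3 := hf1 e he y hy
              have : (lam e * (w y * f e y)) ^ 2 / (K * w y / d e) =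
                  lam e ^ 2 * (d e / K) * (w y * |f e y| ^ 2) := by
                rw [sq_abs]; field_simp
              rw [this]
              refine mul_le_mul_of_nonneg_left (mul_le_mul_of_nonneg_left ?_ h4.le) hdK
              nlinarith [abs_nonneg (f e y)]
          · positivity
      _ = lam e ^ 2 * (d e / K) * ∑ y ∈ U, w y * |f e y| := by rw [mul_sum]
      _ ≤ lam e ^ 2 * (d e / K) * V e := mul_le_mul_of_nonneg_left (hV e he) hdK
      _ = _ := by ring
  obtain ⟨S, hSU, hScard, hS⟩ := exists_sample U p hp0 hp1 ev
    (fun e y => lam e * (w y * f e y)) (fun e => lam e ^ 2 * (d e * V e / K)) cost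
    hga hgb hcost
  refine ⟨S, hSU, hScard.trans ?_, fun e he => ?_⟩
  · have : ∑ y ∈ U, p y ≤ K * ∑ y ∈ U, w y / dd y := by
      rw [mul_sum]
      exact sum_le_sum fun y _ => (min_le_right _ _).trans (le_of_eq (mul_div_assoc _ _ _))
    linarith
  · have h := hS e he
    have hl := hlam e he
    have e1 : ∑ y ∈ S, lam e * (w y * f e y) / p y - ∑ y ∈ U, lam e * (w y * f e y) =
        lam e * (∑ y ∈ S, w y * f e y / p y - ∑ y ∈ U, w y * f e y) := by
      rw [mul_sub, mul_sum, mul_sum]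
      simp only [mul_div_assoc]
    rw [e1, abs_mul, abs_of_pos hl] at h
    refine le_of_mul_le_mul_left (h.trans (le_of_eq ?_)) hl
    field_simp

end Levels

end CSP
namespace CSP

/-! ### One round of sparsification from a cover. -/

section Sparsify

set_option linter.unusedSectionVars false

open Finset

/-- The `4 ℓ` near levels cost `32` together. Beyond them `n` is absorbed because `2 * (2/3)^4 < 1`,
and the tails add at most `4 + 3`. -/
theorem sum_error_le {ℓ n : ℕ} (hℓ : 1 ≤ ℓ) (hn : n ≤ 2 ^ ℓ) (N : ℕ) :
    ∑ j ∈ range N, (if j < 4 * ℓ then 8 / (ℓ : ℝ) else (3 / 4) ^ j + n * (2 / 3) ^ j) ≤ 40 := by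
  have hℓ' : (0 : ℝ) < ℓ := by exact_mod_cast hℓ
  rw [sum_ite]
  have h1 : ∑ j ∈ (range N).filter (fun j => j < 4 * ℓ), 8 / (ℓ : ℝ) ≤ 32 := by
    rw [sum_const, nsmul_eq_mul]
    have : ((range N).filter fun j => j < 4 * ℓ).card ≤ 4 * ℓ := by
      refine (card_le_card (t := range (4 * ℓ)) fun x hx => ?_).trans (card_range _).le
      exact mem_range.mpr (mem_filter.mp hx).2
    have : (((range N).filter fun j => j < 4 * ℓ).card : ℝ) ≤ 4 * ℓ := by exact_mod_cast this
    calc _ ≤ 4 * (ℓ : ℝ) * (8 / ℓ) := by gcongr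
      _ = 32 := by field_simp; norm_num
  have h2 : ∑ j ∈ (range N).filter (fun j => ¬ j < 4 * ℓ), ((3 / 4 : ℝ) ^ j + n * (2 / 3) ^ j) ≤
      ∑ j ∈ Ico (4 * ℓ) N, ((3 / 4 : ℝ) ^ j + n * (2 / 3) ^ j) := by
    refine sum_le_sum_of_subset_of_nonneg (fun x hx => ?_) fun _ _ _ => by positivity
    obtain ⟨hx1, hx2⟩ := mem_filter.mp hx
    exact mem_Ico.mpr ⟨not_lt.mp hx2, mem_range.mp hx1⟩
  simp only [sum_add_distrib, ← mul_sum] at h2 ⊢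
  have h3 := geom_sum_Ico_le_of_lt_one (x := (3 / 4 : ℝ)) (m := 4 * ℓ) (n := N)
    (by norm_num) (by norm_num)
  have h4 := geom_sum_Ico_le_of_lt_one (x := (2 / 3 : ℝ)) (m := 4 * ℓ) (n := N)
    (by norm_num) (by norm_num)
  have h5 : (3 / 4 : ℝ) ^ (4 * ℓ) ≤ 1 := pow_le_one₀ (by norm_num) (by norm_num)
  have h6 : (n : ℝ) * (2 / 3) ^ (4 * ℓ) ≤ 1 := by
    calc (n : ℝ) * (2 / 3) ^ (4 * ℓ) ≤ 2 ^ ℓ * (2 / 3) ^ (4 * ℓ) := by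
          gcongr; exact_mod_cast hn
      _ = (2 * (2 / 3) ^ 4) ^ ℓ := by rw [mul_pow, pow_mul]
      _ ≤ 1 := pow_le_one₀ (by norm_num) (by norm_num)
  have h7 : (n : ℝ) * ∑ j ∈ Ico (4 * ℓ) N, (2 / 3 : ℝ) ^ j ≤ 3 := by
    calc (n : ℝ) * ∑ j ∈ Ico (4 * ℓ) N, (2 / 3 : ℝ) ^ j ≤
        n * ((2 / 3) ^ (4 * ℓ) / (1 - 2 / 3)) :=
          mul_le_mul_of_nonneg_left h4 (Nat.cast_nonneg _)
      _ = 3 * (n * (2 / 3) ^ (4 * ℓ)) := by ring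
      _ ≤ 3 := by linarith
  have h8 : ∑ j ∈ Ico (4 * ℓ) N, (3 / 4 : ℝ) ^ j ≤ 4 := by
    calc ∑ j ∈ Ico (4 * ℓ) N, (3 / 4 : ℝ) ^ j ≤ (3 / 4) ^ (4 * ℓ) / (1 - 3 / 4) := h3
      _ ≤ 1 / (1 - 3 / 4) := div_le_div_of_nonneg_right h5 (by norm_num)
      _ = 4 := by norm_num
  linarith [h1, h2, h7, h8]

theorem exp_neg_four_le : Real.exp (-4) ≤ 1 / 32 := by
  have h1 := Real.exp_one_gt_d9
  have h2 : Real.exp 4 = Real.exp 1 ^ 4 := by rw [← Real.exp_nat_mul]; norm_num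
  have h3 : (2.7 : ℝ) ^ 4 ≤ Real.exp 1 ^ 4 := pow_le_pow_left₀ (by norm_num) (by linarith) 4
  rw [Real.exp_neg, h2, one_div]
  exact inv_anti₀ (by norm_num) (le_trans (by norm_num) h3)

open scoped Classical

variable {Ω Y : Type*} [Fintype Ω] [Fintype Y] {c : Ω → Y → Prop} {rk : Finset Ω → ℕ} {L : ℕ}
  {w : Y → ℝ}

/-- A word has a dyadic scale at which it is light. -/
theorem exists_dyadic_scale {W d : ℝ} (hd : 0 < d) :
    ∃ a : ℕ, W ≤ 2 ^ a * d ∧ (d ≤ W → 2 ^ a * d ≤ 2 * W) := by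
  have hex : ∃ a : ℕ, W / d < 2 ^ a := pow_unbounded_of_one_lt _ one_lt_two
  have hspec := Nat.find_spec hex
  rw [div_lt_iff₀ hd] at hspec
  refine ⟨Nat.find hex, hspec.le, fun h => ?_⟩
  rcases h0 : Nat.find hex with _ | a
  · rw [pow_zero]; linarith
  · have := Nat.find_min hex (m := a) (by omega)
    rw [not_lt, le_div_iff₀ hd] at this
    rw [pow_succ]; linarith

set_option maxHeartbeats 1600000 in
/-- The sparsifier built by sampling at a rate inversely proportional to strength. -/
theorem exists_sparsifier_of_hasCovers (hr : IsRank c rk L) (hw : ∀ y, 0 ≤ w y) {q n ℓ : ℕ}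
    (hq : 1 ≤ q) (hn : 1 ≤ n) (hℓ : 1 ≤ ℓ) (hnℓ : n ≤ 2 ^ ℓ)
    (hΩ : (Fintype.card Ω : ℝ) ≤ Real.exp (q * n)) (hL : L ≤ n * q ^ 2) {C ε : ℝ} (hC : 0 ≤ C)
    (hε : 0 < ε) (hε1 : ε ≤ 1)
    (hcov : HasCovers c rk w (univ.filter fun y => 0 < w y) C ℓ n ε) :
    ∃ v : Y → ℝ, (∀ y, 0 ≤ v y) ∧
      ((univ.filter fun y => 0 < v y).card : ℝ) ≤
        4 * ((C + 3 * q + 9) * ℓ ^ 3 / ε ^ 2) * L + 2 ∧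
      ∀ σ, |∑ y ∈ univ.filter (c σ), v y - ∑ y ∈ univ.filter (c σ), w y| ≤
        40 * ε * ∑ y ∈ univ.filter (c σ), w y := by
  have hℓ0 : (1 : ℝ) ≤ ℓ := by exact_mod_cast hℓ
  have hn0 : (1 : ℝ) ≤ n := by exact_mod_cast hn
  have hq0 : (1 : ℝ) ≤ q := by exact_mod_cast hq
  have hnexp : (n : ℝ) ≤ Real.exp n := by linarith [Real.add_one_le_exp (n : ℝ)]
  have hqexp : (q : ℝ) ≤ Real.exp q := by linarith [Real.add_one_le_exp (q : ℝ)]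
  have hLr : (L : ℝ) ≤ n * q ^ 2 := by exact_mod_cast hL
  set A : ℝ := C + 3 * q + 9 with hA
  have hA0 : 0 < A := by positivity
  -- Two factors `ℓ` come from demanding accuracy `ε / ℓ` on each near level, the third from the
  -- `exp (C 2^a ℓ)` representatives in the union bound.
  set K : ℝ := A * ℓ ^ 3 / ε ^ 2 with hK
  have hK0 : 0 < K := by positivity
  set Z₀ : Finset Y := univ.filter fun y => 0 < w y with hZ₀
  have hwZ₀ : ∀ y ∈ Z₀, 0 < w y := fun y hy => (mem_filter.mp hy).2
  obtain ⟨T, d₀, Z, hd₀, hZ0, hanti, hstrong, hlast, hsum, hI⟩ := exists_levels hr hw hwZ₀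
  set d : ℕ → ℝ := fun i => d₀ * 2 ^ i with hd
  have hdpos : ∀ i, 0 < d i := fun i => by positivity
  have hZsub : ∀ i, Z i ⊆ Z₀ := fun i => hZ0 ▸ hanti (Nat.zero_le i)
  set Yl : ℕ → Finset Y := fun i => Z i \ Z (i + 1) with hYl
  set I : Finset ℕ := (range T).filter fun i => (Yl i).Nonempty with hIdef
  have hYuniq : ∀ i j y, y ∈ Yl i → y ∈ Yl j → i = j := by
    have key : ∀ i j y, i < j → y ∈ Yl i → y ∉ Yl j := by
      intro i j y hij hi hj
      exact (mem_sdiff.mp hi).2 (hanti hij (mem_sdiff.mp hj).1)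
    intro i j y hi hj
    rcases lt_trichotomy i j with h | h | h
    · exact absurd hj (key i j y h hi)
    · exact h
    · exact absurd hi (key j i y h hj)
  set U : Finset Y := (range T).biUnion Yl with hU
  have hYU : ∀ i ∈ range T, Yl i ⊆ U := fun i hi => subset_biUnion_of_mem Yl hi
  have hUZ : U ⊆ Z₀ := biUnion_subset.mpr fun i _ => sdiff_subset.trans (hZsub i)
  have hdisj : Set.PairwiseDisjoint (↑(range T)) Yl := by
    intro i _ j _ hij
    exact disjoint_left.mpr fun y hi hj => hij (hYuniq i j y hi hj)
  obtain ⟨lv, hlv⟩ : ∃ lv : Y → ℕ, ∀ i y, y ∈ Yl i → lv y = i := by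
    refine ⟨fun y => if h : ∃ i, y ∈ Yl i then h.choose else 0, fun i y hy => ?_⟩
    have h : ∃ i, y ∈ Yl i := ⟨i, hy⟩
    simp only [dif_pos h]
    exact hYuniq _ _ y h.choose_spec hy
  -- words on a level
  set F : ℕ → Ω → Y → ℝ := fun i σ y => if y ∈ Yl i ∧ c σ y then 1 else 0 with hF
  have hFne : ∀ i σ y, F i σ y ≠ 0 → y ∈ Yl i ∧ c σ y := by
    intro i σ y h
    by_contra hn'
    exact h (if_neg hn')
  have hF01 : ∀ i σ y, 0 ≤ F i σ y ∧ F i σ y ≤ 1 := by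
    intro i σ y; simp only [hF]; split_ifs <;> simp
  set Wi : ℕ → Ω → ℝ := fun i σ => ∑ y ∈ (Z i).filter (c σ), w y with hWi
  set W : Ω → ℝ := fun σ => ∑ y ∈ univ.filter (c σ), w y with hW
  have hWiW : ∀ i σ, Wi i σ ≤ W σ := fun i σ =>
    sum_le_sum_of_subset_of_nonneg (filter_subset_filter _ (subset_univ _)) fun _ _ _ => hw _
  have hFsum : ∀ i σ, ∑ y ∈ U, w y * |F i σ y| ≤ Wi i σ := by
    intro i σ
    have e : ∀ y, w y * |F i σ y| = if y ∈ Yl i ∧ c σ y then w y else 0 := by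
      intro y; simp only [hF]; split_ifs <;> simp
    simp only [e, ← sum_filter]
    refine sum_le_sum_of_subset_of_nonneg (fun y hy => ?_) fun _ _ _ => hw _
    obtain ⟨-, h1, h2⟩ := mem_filter.mp hy
    exact mem_filter.mpr ⟨(mem_sdiff.mp h1).1, h2⟩
  -- representatives
  choose P hP1 hP2 hP3 using fun i (a : ℕ) =>
    hcov (d i) (hdpos i) (Z i) (hZsub i) (hstrong i) ((2 : ℝ) ^ a) (by positivity)
  have hrep : ∀ i σ, ∃ (a : ℕ) (p : Ω), Wi i σ ≤ 2 ^ a * d i ∧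
      (d i ≤ Wi i σ → 2 ^ a * d i ≤ 2 * Wi i σ) ∧ p ∈ P i a ∧
      ∑ y ∈ (Z i).filter (fun y => ¬ (c σ y ↔ c p y)), w y ≤ 2 ^ a * d i / n ∧
        ((∀ y ∈ Z i, (c σ y ↔ c p y)) ∨ ε * n ≤ 1) := by
    intro i σ
    obtain ⟨a, ha1, ha2⟩ := exists_dyadic_scale (W := Wi i σ) (hdpos i)
    obtain ⟨p, hp1, hp2, hp3⟩ := hP3 i a σ ha1
    exact ⟨a, p, ha1, ha2, hp1, hp2, hp3⟩
  choose sc rp hsc1 hsc2 hrp1 hrp2 hrp3 using hrep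
  -- `M σ` is the dyadic scale of the whole word. Words lighter than `d₀` vanish on every level, so
  -- their value is irrelevant.
  have hMex : ∀ σ, ∃ M : ℕ, d₀ ≤ W σ → d M ≤ W σ ∧ W σ < d (M + 1) := by
    intro σ
    by_cases h : d₀ ≤ W σ
    · obtain ⟨M, h1, h2⟩ := exists_nat_pow_near ((one_le_div hd₀).mpr h) (one_lt_two (α := ℝ))
      rw [le_div_iff₀ hd₀] at h1
      rw [div_lt_iff₀ hd₀] at h2
      exact ⟨M, fun _ => ⟨by simp only [hd]; linarith, by simp only [hd]; linarith⟩⟩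
    · exact ⟨0, fun h' => absurd h' h⟩
  choose M hM using hMex
  -- the three kinds of events
  set ev : Finset ((ℕ × Ω) ⊕ ((ℕ × Ω) ⊕ (ℕ × ℕ × Ω))) :=
    (I ×ˢ univ).disjSum ((I ×ˢ univ).disjSum
      ((I ×ˢ (range (4 * ℓ + 1) ×ˢ univ)).filter fun x => x.2.2 ∈ P x.1 x.2.1)) with hev
  set f : (ℕ × Ω) ⊕ ((ℕ × Ω) ⊕ (ℕ × ℕ × Ω)) → Y → ℝ :=
    Sum.elim (fun x => F x.1 x.2) (Sum.elim
      (fun x y => F x.1 x.2 y - F x.1 (rp x.1 x.2) y) (fun x => F x.1 x.2.2)) with hf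
  set de : (ℕ × Ω) ⊕ ((ℕ × Ω) ⊕ (ℕ × ℕ × Ω)) → ℝ :=
    Sum.elim (fun x => d x.1) (Sum.elim (fun x => d x.1) (fun x => d x.1)) with hde
  -- Far levels get a discount `(3/4)^j`, making the variance term geometric. Links have variance
  -- smaller by `n`, which allows a larger parameter by `n`; the constraint `lam * d ≤ K` then needs
  -- `ε n ≤ 1`, unless the link is zero.
  set lam : (ℕ × Ω) ⊕ ((ℕ × Ω) ⊕ (ℕ × ℕ × Ω)) → ℝ :=
    Sum.elim (fun x => ε * K * (3 / 4) ^ (M x.2 - x.1) / d x.1) (Sum.elim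
      (fun x => ε / ℓ * K * n / d x.1) (fun x => ε / ℓ * K / d x.1)) with hlam
  set V : (ℕ × Ω) ⊕ ((ℕ × Ω) ⊕ (ℕ × ℕ × Ω)) → ℝ :=
    Sum.elim (fun x => W x.2) (Sum.elim
      (fun x => 2 ^ sc x.1 x.2 * d x.1 / n) (fun x => 2 ^ x.2.1 * d x.1)) with hV
  -- The first two kinds range over all `exp (q n)` words, the third only over representatives; `A`
  -- is large enough to beat these counts and the number of levels.
  set cost : (ℕ × Ω) ⊕ ((ℕ × Ω) ⊕ (ℕ × ℕ × Ω)) → ℝ :=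
    Sum.elim (fun _ => A * n) (Sum.elim (fun _ => A * n) (fun x => A * 2 ^ x.2.1 * ℓ)) with hcost
  have hevI : ∀ e ∈ ev, ∃ i ∈ I, de e = d i ∧ ∀ y, f e y ≠ 0 → y ∈ Yl i := by
    rintro (⟨i, σ⟩ | ⟨i, σ⟩ | ⟨i, a, p⟩) he
    · simp only [hev, inl_mem_disjSum, mem_product] at he
      exact ⟨i, he.1, rfl, fun y hy => (hFne _ _ _ hy).1⟩
    · simp only [hev, inr_mem_disjSum, inl_mem_disjSum, mem_product] at he
      refine ⟨i, he.1, rfl, fun y hy => ?_⟩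
      by_contra hnot
      apply hy
      simp [hf, hF, hnot]
    · simp only [hev, inr_mem_disjSum, mem_filter, mem_product] at he
      exact ⟨i, he.1.1, rfl, fun y hy => (hFne _ _ _ hy).1⟩
  have hεℓ : ε / ℓ ≤ 1 := by
    rw [div_le_one (by linarith)]; linarith
  have hlamd : ∀ e ∈ ev, ∀ y ∈ U, f e y ≠ 0 → lam e * de e ≤ K := by
    rintro (⟨i, σ⟩ | ⟨i, σ⟩ | ⟨i, a, p⟩) he y hy hne
    · simp only [hlam, hde, Sum.elim_inl]
      rw [div_mul_cancel₀ _ (hdpos i).ne']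
      have : (3 / 4 : ℝ) ^ (M σ - i) ≤ 1 := pow_le_one₀ (by norm_num) (by norm_num)
      calc ε * K * (3 / 4) ^ (M σ - i) ≤ 1 * K * 1 := by gcongr
        _ = K := by ring
    · simp only [hlam, hde, Sum.elim_inl, Sum.elim_inr]
      rw [div_mul_cancel₀ _ (hdpos i).ne']
      rcases hrp3 i σ with h | h
      · exfalso
        apply hne
        simp only [hf, hF, Sum.elim_inl, Sum.elim_inr]
        by_cases hyi : y ∈ Yl i
        · have := h y (mem_sdiff.mp hyi).1
          simp only [this, sub_self]
        · simp [hyi]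
      · calc ε / ℓ * K * n = (ε * n) * K / ℓ := by ring
          _ ≤ 1 * K / 1 := by gcongr
          _ = K := by ring
    · simp only [hlam, hde, Sum.elim_inr]
      rw [div_mul_cancel₀ _ (hdpos i).ne']
      nlinarith
  have hlampos : ∀ e, 0 < lam e := by
    rintro (⟨i, σ⟩ | ⟨i, σ⟩ | ⟨i, a, p⟩)
    · have := hdpos i
      simp only [hlam, Sum.elim_inl]; positivity
    · have := hdpos i
      simp only [hlam, Sum.elim_inl, Sum.elim_inr]; positivity
    · have := hdpos i
      simp only [hlam, Sum.elim_inr]; positivity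
  have hf1 : ∀ e, ∀ y, |f e y| ≤ 1 := by
    rintro (⟨i, σ⟩ | ⟨i, σ⟩ | ⟨i, a, p⟩) y
    · have := hF01 i σ y
      simp only [hf, Sum.elim_inl]
      rw [abs_le]; constructor <;> linarith
    · have h1 := hF01 i σ y
      have h2 := hF01 i (rp i σ) y
      simp only [hf, Sum.elim_inl, Sum.elim_inr]
      rw [abs_le]; constructor <;> linarith
    · have := hF01 i p y
      simp only [hf, Sum.elim_inr]
      rw [abs_le]; constructor <;> linarith
  have hVe : ∀ e ∈ ev, ∑ y ∈ U, w y * |f e y| ≤ V e := by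
    rintro (⟨i, σ⟩ | ⟨i, σ⟩ | ⟨i, a, p⟩) he
    · exact (hFsum i σ).trans (hWiW i σ)
    · refine le_trans ?_ (hrp2 i σ)
      have e : ∀ y, w y * |F i σ y - F i (rp i σ) y| =
          if y ∈ Yl i ∧ ¬ (c σ y ↔ c (rp i σ) y) then w y else 0 := by
        intro y
        by_cases h1 : y ∈ Yl i <;> by_cases h2 : c σ y <;> by_cases h3 : c (rp i σ) y <;>
          simp [hF, h1, h2, h3]
      change ∑ y ∈ U, w y * |F i σ y - F i (rp i σ) y| ≤ _
      simp only [e, ← sum_filter]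
      refine sum_le_sum_of_subset_of_nonneg (fun y hy => ?_) fun _ _ _ => hw _
      obtain ⟨-, h1, h2⟩ := mem_filter.mp hy
      exact mem_filter.mpr ⟨(mem_sdiff.mp h1).1, h2⟩
    · simp only [hev, inr_mem_disjSum, mem_filter, mem_product] at he
      exact (hFsum i p).trans (hP1 i a p he.2)
  have hIcard : (I.card : ℝ) ≤ n * q ^ 2 := le_trans (by exact_mod_cast hI) hLr
  have hcost1 : (I.card : ℝ) * (Fintype.card Ω * Real.exp (-(A * n))) ≤ 1 / 32 := by
    calc (I.card : ℝ) * (Fintype.card Ω * Real.exp (-(A * n))) ≤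
        (Real.exp n * Real.exp q ^ 2) * (Real.exp (q * n) * Real.exp (-(A * n))) := by
          refine mul_le_mul (hIcard.trans ?_) ?_ (by positivity) (by positivity)
          · gcongr
          · gcongr
      _ = Real.exp (n + 2 * q + q * n - A * n) := by
          rw [← Real.exp_nat_mul, ← Real.exp_add, ← Real.exp_add, ← Real.exp_add]
          congr 1; push_cast; ring
      _ ≤ Real.exp (-4) := Real.exp_le_exp.mpr (by
          rw [hA]
          have h1 : (q : ℝ) ≤ q * n := le_mul_of_one_le_right (by linarith) hn0
          have h2 : 0 ≤ C * n := by positivity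
          nlinarith)
      _ ≤ _ := exp_neg_four_le
  have hcost2 : ∑ x ∈ (I ×ˢ (range (4 * ℓ + 1) ×ˢ (univ : Finset Ω))).filter
      (fun x => x.2.2 ∈ P x.1 x.2.1), Real.exp (-(A * 2 ^ x.2.1 * ℓ)) ≤ 1 / 32 := by
    rw [sum_filter, sum_product]
    have h1 : ∀ i ∈ I, ∑ x ∈ range (4 * ℓ + 1) ×ˢ (univ : Finset Ω),
        (if x.2 ∈ P i x.1 then Real.exp (-(A * 2 ^ x.1 * ℓ)) else 0) ≤
          (4 * ℓ + 1) * Real.exp ((C - A) * ℓ) := by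
      intro i _
      rw [sum_product]
      calc _ ≤ ∑ a ∈ range (4 * ℓ + 1), Real.exp ((C - A) * ℓ) := by
            refine sum_le_sum fun a _ => ?_
            have hfP : (univ : Finset Ω).filter (fun p => p ∈ P i a) = P i a := by ext; simp
            rw [← sum_filter]
            simp only [hfP, sum_const, nsmul_eq_mul]
            calc _ ≤ Real.exp (C * 2 ^ a * ℓ) * Real.exp (-(A * 2 ^ a * ℓ)) :=
                  mul_le_mul_of_nonneg_right (hP2 i a) (Real.exp_pos _).le
              _ = Real.exp ((C - A) * ℓ * 2 ^ a) := by rw [← Real.exp_add]; ring_nf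
              _ ≤ _ := Real.exp_le_exp.mpr (by
                  have h2 : (1 : ℝ) ≤ 2 ^ a := one_le_pow₀ (by norm_num)
                  have h3 : (C - A) * ℓ ≤ 0 := by
                    rw [hA]; nlinarith
                  nlinarith)
        _ = _ := by rw [sum_const, card_range, nsmul_eq_mul]; push_cast; ring
    refine (sum_le_sum h1).trans ?_
    rw [sum_const, nsmul_eq_mul]
    have hnl : (n : ℝ) ≤ Real.exp ℓ := by
      have e1 : (n : ℝ) ≤ 2 ^ ℓ := by exact_mod_cast hnℓ
      have e2 : (2 : ℝ) ^ ℓ ≤ Real.exp 1 ^ ℓ :=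
        pow_le_pow_left₀ (by norm_num) (by linarith [Real.exp_one_gt_d9]) _
      rw [← Real.exp_nat_mul, mul_one] at e2
      exact e1.trans e2
    calc (I.card : ℝ) * ((4 * ℓ + 1) * Real.exp ((C - A) * ℓ)) ≤
        (Real.exp ℓ * Real.exp q ^ 2) * (Real.exp (4 * ℓ) * Real.exp ((C - A) * ℓ)) := by
          refine mul_le_mul (hIcard.trans ?_) ?_ (by positivity) (by positivity)
          · gcongr
          · gcongr
            exact Real.add_one_le_exp _
      _ = Real.exp (ℓ + 2 * q + 4 * ℓ + (C - A) * ℓ) := by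
          rw [← Real.exp_nat_mul, ← Real.exp_add, ← Real.exp_add, ← Real.exp_add]
          congr 1; push_cast; ring
      _ ≤ Real.exp (-4) := Real.exp_le_exp.mpr (by
          rw [hA]
          have h1 : (q : ℝ) ≤ q * ℓ := le_mul_of_one_le_right (by linarith) hℓ0
          nlinarith)
      _ ≤ _ := exp_neg_four_le
  have hcosts : ∑ e ∈ ev, Real.exp (-cost e) ≤ 1 / 8 := by
    rw [hev, sum_disjSum, sum_disjSum]
    have h1 : ∑ x ∈ I ×ˢ (univ : Finset Ω), Real.exp (-cost (Sum.inl x)) ≤ 1 / 32 := by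
      rw [sum_product]
      simpa [hcost] using hcost1
    have h2 : ∑ x ∈ I ×ˢ (univ : Finset Ω), Real.exp (-cost (Sum.inr (Sum.inl x))) ≤ 1 / 32 := by
      rw [sum_product]
      simpa [hcost] using hcost1
    have h3 : ∑ x ∈ (I ×ˢ (range (4 * ℓ + 1) ×ˢ (univ : Finset Ω))).filter
      (fun x => x.2.2 ∈ P x.1 x.2.1), Real.exp (-cost (Sum.inr (Sum.inr x))) ≤ 1 / 32 := hcost2
    linarith
  obtain ⟨S, hSU, hScard, hS⟩ := exists_scaled_sample U w (fun y => d (lv y)) hK0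
    (fun y hy => hwZ₀ y (hUZ hy)) (fun y _ => hdpos _) ev f de lam V cost
    (fun e _ => hlampos e) (fun e he => by
      obtain ⟨i, -, h, -⟩ := hevI e he
      rw [h]; exact hdpos i) (fun e _ y _ => hf1 e y) (fun e he y hy hne => by
      obtain ⟨i, -, h1, h2⟩ := hevI e he
      refine ⟨?_, hlamd e he y hy hne⟩
      rw [h1, hlv i y (h2 y hne)]) hVe hcosts
  set p : Y → ℝ := fun y => min 1 (K * w y / d (lv y)) with hp
  have hp0 : ∀ y ∈ S, 0 < p y := fun y hy =>
    lt_min one_pos (div_pos (mul_pos hK0 (hwZ₀ y (hUZ (hSU hy)))) (hdpos _))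
  set Dev : (Y → ℝ) → ℝ := fun h => ∑ y ∈ S, w y * h y / p y - ∑ y ∈ U, w y * h y with hDev
  have hDlow : ∀ i ∈ I, ∀ σ, |Dev (F i σ)| ≤
      ε * (3 / 4) ^ (M σ - i) * W σ + A * n / (ε * K * (3 / 4) ^ (M σ - i) / d i) := by
    intro i hi σ
    have h := hS (Sum.inl (i, σ)) (by simp [hev, hi])
    simp only [f, de, lam, V, cost, Sum.elim_inl] at h
    refine h.trans (le_of_eq ?_)
    have := (hdpos i).ne'
    congr 1
    field_simp
  have hDlink : ∀ i ∈ I, ∀ σ, |Dev (F i σ) - Dev (F i (rp i σ))| ≤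
      ε / ℓ * (2 ^ sc i σ * d i) + A * n / (ε / ℓ * K * n / d i) := by
    intro i hi σ
    have h := hS (Sum.inr (Sum.inl (i, σ))) (by simp [hev, hi])
    simp only [f, de, lam, V, cost, Sum.elim_inl, Sum.elim_inr] at h
    have e : Dev (F i σ) - Dev (F i (rp i σ)) =
        ∑ y ∈ S, w y * (F i σ y - F i (rp i σ) y) / min 1 (K * w y / d (lv y)) -
          ∑ y ∈ U, w y * (F i σ y - F i (rp i σ) y) := by
      simp only [hDev, hp, mul_sub, sub_div, sum_sub_distrib]
      ring
    rw [e]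
    refine h.trans (le_of_eq ?_)
    have := (hdpos i).ne'
    congr 1
    field_simp
  have hDrep : ∀ i ∈ I, ∀ a ≤ 4 * ℓ, ∀ τ ∈ P i a, |Dev (F i τ)| ≤
      ε / ℓ * (2 ^ a * d i) + A * 2 ^ a * ℓ / (ε / ℓ * K / d i) := by
    intro i hi a ha τ hτ
    have h := hS (Sum.inr (Sum.inr (i, a, τ)))
      (by simp only [hev, inr_mem_disjSum, mem_filter, mem_product, mem_range, mem_univ,
            and_true]; exact ⟨⟨hi, by omega⟩, hτ⟩)
    simp only [f, de, lam, V, cost, Sum.elim_inr] at h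
    refine h.trans (le_of_eq ?_)
    have := (hdpos i).ne'
    congr 1
    field_simp
  have hFzero : ∀ i σ, (∀ y ∈ Yl i, ¬ c σ y) → Dev (F i σ) = 0 := by
    intro i σ h
    have : F i σ = fun _ => 0 := by
      funext y
      by_contra hne
      obtain ⟨h1, h2⟩ := hFne i σ y hne
      exact h y h1 h2
    simp [hDev, this]
  have hlevel : ∀ σ, ∀ i ∈ range T, |Dev (F i σ)| ≤ if i ≤ M σ then
      (if M σ - i < 4 * ℓ then 8 / (ℓ : ℝ) else (3 / 4) ^ (M σ - i) + n * (2 / 3) ^ (M σ - i)) *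
        (ε * W σ) else 0 := by
    intro σ i hiT
    have hW0 : 0 ≤ W σ := sum_nonneg fun y _ => hw y
    have hrhs : 0 ≤ if i ≤ M σ then
      (if M σ - i < 4 * ℓ then 8 / (ℓ : ℝ) else (3 / 4) ^ (M σ - i) + n * (2 / 3) ^ (M σ - i)) *
        (ε * W σ) else 0 := by
      split_ifs <;> positivity
    by_cases hz : ∀ y ∈ Yl i, ¬ c σ y
    · rw [hFzero i σ hz, abs_zero]; exact hrhs
    push Not at hz
    obtain ⟨y, hyi, hcy⟩ := hz
    have hiI : i ∈ I := mem_filter.mpr ⟨hiT, y, hyi⟩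
    have hdW : d i ≤ Wi i σ :=
      (hstrong i).le_weight hr (hdpos i).le hw (mem_sdiff.mp hyi).1 hcy
    have hdW' : d i ≤ W σ := hdW.trans (hWiW i σ)
    have hd0W : d₀ ≤ W σ := by
      refine le_trans ?_ hdW'
      exact le_mul_of_one_le_right hd₀.le (one_le_pow₀ (by norm_num))
    obtain ⟨hM1, hM2⟩ := hM σ hd0W
    have hiM : i ≤ M σ := by
      by_contra hlt
      have h1 : d (M σ + 1) ≤ d i := by
        simp only [hd]
        exact mul_le_mul_of_nonneg_left (pow_le_pow_right₀ (by norm_num) (by omega)) hd₀.le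
      linarith
    rw [if_pos hiM]
    set j := M σ - i with hj
    have hdj : d (M σ) = d i * 2 ^ j := by
      simp only [hd]
      rw [mul_assoc, ← pow_add]
      congr 2
      omega
    split_ifs with hjl
    -- On a near level the scale is at most `j + 1`, so its representative is among the controlled
    -- events.
    · have hsc : sc i σ ≤ 4 * ℓ := by
        have h1 := hsc2 i σ hdW
        have h2 : (2 : ℝ) ^ sc i σ < 2 ^ (j + 2) := by
          have h3 : d (M σ + 1) = d i * 2 ^ (j + 1) := by
            have : d (M σ + 1) = d (M σ) * 2 := by simp only [hd]; ring
            rw [this, hdj]; ring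
          have h4 := hWiW i σ
          have h5 : 2 ^ sc i σ * d i < 2 ^ (j + 2) * d i := by
            rw [h3] at hM2
            calc _ ≤ 2 * Wi i σ := h1
              _ < 2 * (d i * 2 ^ (j + 1)) := by linarith
              _ = _ := by ring
          exact lt_of_mul_lt_mul_right h5 (hdpos i).le
        have := (pow_lt_pow_iff_right₀ (one_lt_two (α := ℝ))).mp h2
        omega
      have h1 := hDlink i hiI σ
      have h2 := hDrep i hiI _ hsc _ (hrp1 i σ)
      have h3 : A * n / (ε / ℓ * K * n / d i) ≤ ε / ℓ * (2 ^ sc i σ * d i) := by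
        have e : A * n / (ε / ℓ * K * n / d i) = ε / ℓ * (1 / ℓ * d i) := by
          rw [hK]
          have := (hdpos i).ne'
          field_simp
        rw [e]
        have : (1 : ℝ) / ℓ ≤ 2 ^ sc i σ :=
          le_trans ((div_le_one (by linarith)).mpr hℓ0) (one_le_pow₀ (by norm_num))
        have := (hdpos i).le
        gcongr
      have h4 : A * 2 ^ sc i σ * ℓ / (ε / ℓ * K / d i) = ε / ℓ * (2 ^ sc i σ * d i) := by
        rw [hK]
        have := (hdpos i).ne'
        field_simp
      rw [h4] at h2
      -- Link and representative contribute two equal bounds each; with `2^a d ≤ 2 W` this becomes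
      -- `8 / ℓ`.
      have h5 : |Dev (F i σ)| ≤ 4 * (ε / ℓ * (2 ^ sc i σ * d i)) := by
        have := abs_sub_abs_le_abs_sub (Dev (F i σ)) (Dev (F i (rp i σ)))
        linarith
      have h6 : 2 ^ sc i σ * d i ≤ 2 * W σ := (hsc2 i σ hdW).trans (by linarith [hWiW i σ])
      calc _ ≤ 4 * (ε / ℓ * (2 ^ sc i σ * d i)) := h5
        _ ≤ 4 * (ε / ℓ * (2 * W σ)) := by gcongr
        _ = _ := by ring
    · refine (hDlow i hiI σ).trans ?_
      have h1 : A * n / (ε * K * (3 / 4) ^ j / d i) =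
          n * ε / ℓ ^ 3 * ((4 / 3) ^ j * d i) := by
        rw [hK]
        have := (hdpos i).ne'
        have e : ((4 : ℝ) / 3) ^ j = ((3 / 4) ^ j)⁻¹ := by rw [← inv_pow]; norm_num
        rw [e]
        field_simp
      -- Inverting the discount costs `(4/3)^j`, but the level is weaker than the word by `2^j`.
      have h2 : (4 / 3) ^ j * d i ≤ (2 / 3) ^ j * W σ := by
        have e : ((4 : ℝ) / 3) ^ j = (2 / 3) ^ j * 2 ^ j := by rw [← mul_pow]; norm_num
        rw [hdj] at hM1
        calc (4 / 3) ^ j * d i = (2 / 3) ^ j * (d i * 2 ^ j) := by rw [e]; ring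
          _ ≤ _ := mul_le_mul_of_nonneg_left hM1 (by positivity)
      have h3 : n * ε / ℓ ^ 3 * ((4 / 3) ^ j * d i) ≤ n * ε * ((2 / 3) ^ j * W σ) := by
        have h4 : n * ε / (ℓ : ℝ) ^ 3 ≤ n * ε := div_le_self (by positivity) (one_le_pow₀ hℓ0)
        have := (hdpos i).le
        exact mul_le_mul h4 h2 (by positivity) (by positivity)
      rw [h1]
      linarith
  have hcZ : ∀ σ y, y ∈ U → (if c σ y then (1 : ℝ) else 0) = ∑ i ∈ range T, F i σ y := by
    intro σ y hy
    obtain ⟨i, hi, hyi⟩ := mem_biUnion.mp hy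
    rw [sum_eq_single_of_mem i hi]
    · simp [hF, hyi]
    · intro k _ hk
      by_contra hne
      exact hk (hYuniq k i y (hFne k σ y hne).1 hyi)
  have hUmem : ∀ σ y, c σ y → 0 < w y → y ∈ U := by
    intro σ y hc hwy
    have hyZ : y ∈ Z 0 := by rw [hZ0]; simp [hZ₀, hwy]
    have hex : ∃ i, y ∉ Z i := ⟨T, fun h => hlast σ y h hc⟩
    have h1 := Nat.find_spec hex
    have h2 : Nat.find hex ≤ T := Nat.find_min' hex fun h => hlast σ y h hc
    rcases h0 : Nat.find hex with _ | i
    · rw [h0] at h1; exact absurd hyZ h1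
    · have h3 := Nat.find_min hex (m := i) (by omega)
      rw [not_not] at h3
      rw [h0] at h1
      exact mem_biUnion.mpr ⟨i, mem_range.mpr (by omega), mem_sdiff.mpr ⟨h3, h1⟩⟩
  refine ⟨fun y => if y ∈ S then w y / p y else 0, fun y => ?_, ?_, fun σ => ?_⟩
  · dsimp only
    split_ifs with h
    · exact div_nonneg (hw y) (hp0 y h).le
    · exact le_rfl
  · have h1 : (univ.filter fun y => 0 < if y ∈ S then w y / p y else 0) ⊆ S := by
      intro y hy
      by_contra hn'
      simp [hn'] at hy
    have h2 : ((univ.filter fun y => 0 < if y ∈ S then w y / p y else 0).card : ℝ) ≤ S.card := by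
      exact_mod_cast card_le_card h1
    have h3 : ∑ y ∈ U, w y / d (lv y) ≤ 2 * L := by
      refine le_trans (le_of_eq ?_) hsum
      rw [hU, sum_biUnion hdisj]
      refine sum_congr rfl fun i _ => ?_
      rw [sum_div]
      refine sum_congr rfl fun y hy => ?_
      rw [hlv i y hy]
    have h4 : K * ∑ y ∈ U, w y / d (lv y) ≤ K * (2 * L) := mul_le_mul_of_nonneg_left h3 hK0.le
    linarith
  · have e1 : ∑ y ∈ univ.filter (c σ), (if y ∈ S then w y / p y else 0) =
        ∑ y ∈ S, w y * (∑ i ∈ range T, F i σ y) / p y := by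
      rw [sum_filter, ← sum_subset (subset_univ S)]
      · refine sum_congr rfl fun y hy => ?_
        rw [← hcZ σ y (hSU hy), if_pos hy]
        split_ifs <;> simp
      · intro y _ hy
        simp [hy]
    have e2 : ∑ y ∈ univ.filter (c σ), w y = ∑ y ∈ U, w y * ∑ i ∈ range T, F i σ y := by
      rw [sum_filter, ← sum_subset (subset_univ U)]
      · refine sum_congr rfl fun y hy => ?_
        rw [← hcZ σ y hy]
        split_ifs <;> simp
      · intro y _ hy
        split_ifs with hc
        · by_contra hne
          exact hy (hUmem σ y hc (lt_of_le_of_ne (hw y) (Ne.symm hne)))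
        · rfl
    have e3 : ∑ y ∈ univ.filter (c σ), (if y ∈ S then w y / p y else 0) -
        ∑ y ∈ univ.filter (c σ), w y = ∑ i ∈ range T, Dev (F i σ) := by
      rw [e1, e2]
      simp only [hDev, sum_sub_distrib, mul_sum, sum_div]
      rw [sum_comm, sum_comm (s := U)]
    have hW0 : 0 ≤ W σ := sum_nonneg fun y _ => hw y
    rw [e3]
    set b : ℕ → ℝ := fun j =>
      if j < 4 * ℓ then 8 / (ℓ : ℝ) else (3 / 4) ^ j + n * (2 / 3) ^ j with hb
    have hb0 : ∀ j, 0 ≤ b j := fun j => by simp only [hb]; split_ifs <;> positivity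
    calc |∑ i ∈ range T, Dev (F i σ)| ≤ ∑ i ∈ range T, |Dev (F i σ)| := abs_sum_le_sum_abs _ _
      _ ≤ ∑ i ∈ range T, (if i ≤ M σ then b (M σ - i) * (ε * W σ) else 0) :=
          sum_le_sum (hlevel σ)
      _ = ∑ i ∈ (range T).filter (fun i => i ≤ M σ), b (M σ - i) * (ε * W σ) :=
          (sum_filter _ _).symm
      _ ≤ ∑ i ∈ range (M σ + 1), b (M σ - i) * (ε * W σ) := by
          refine sum_le_sum_of_subset_of_nonneg (fun i hi => ?_) fun i _ _ =>
            mul_nonneg (hb0 _) (by positivity)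
          exact mem_range.mpr (Nat.lt_succ_of_le (mem_filter.mp hi).2)
      _ = (∑ j ∈ range (M σ + 1), b j) * (ε * W σ) := by
          rw [← sum_mul, ← sum_range_reflect b]
          congr 1
      _ ≤ 40 * (ε * W σ) :=
          mul_le_mul_of_nonneg_right (sum_error_le hℓ hnℓ _) (by positivity)
      _ = _ := by ring

end Sparsify

end CSP
namespace CSP

/-! ### Two rounds, with a bound independent of the number of clauses. -/

section Compose

open Finset
open scoped Classical

set_option maxHeartbeats 1000000 in
/-- Codes with a linear rank function and exponentially many words have near-linear sparsifiers. -/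
theorem exists_sparsifier {Ω Y : Type*} [Fintype Ω] [Fintype Y] {c : Ω → Y → Prop}
    {rk : Finset Ω → ℕ} {L : ℕ} {w : Y → ℝ} (hr : IsRank c rk L) (hw : ∀ y, 0 ≤ w y) {q n : ℕ}
    (hq : 1 ≤ q) (hn : 2 ≤ n) (hΩ : Fintype.card Ω ≤ q ^ n) (hL : L ≤ n * q ^ 2) {ε : ℝ}
    (hε : 0 < ε) (hε1 : ε < 1) :
    ∃ v : Y → ℝ, (∀ y, 0 ≤ v y) ∧
      ((univ.filter fun y => 0 < v y).card : ℝ) ≤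
        108 * (160000 * (13 * q + 35) * q ^ 2 + 2) * (n * Real.log n ^ 6 / ε ^ 2) ∧
      ∀ σ, |∑ y ∈ univ.filter (c σ), v y - ∑ y ∈ univ.filter (c σ), w y| ≤
        ε * ∑ y ∈ univ.filter (c σ), w y := by
  set ℓ : ℕ := Nat.clog 2 n with hℓdef
  have hℓ : 1 ≤ ℓ := Nat.clog_pos (by norm_num) hn
  have hnℓ : n ≤ 2 ^ ℓ := Nat.le_pow_clog (by norm_num) n
  have hℓ0 : (1 : ℝ) ≤ ℓ := by exact_mod_cast hℓ
  have hn2 : (2 : ℝ) ≤ n := by exact_mod_cast hn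
  have hn0 : (1 : ℝ) ≤ n := by linarith
  have hq0 : (1 : ℝ) ≤ q := by exact_mod_cast hq
  have hqexp : (q : ℝ) ≤ Real.exp q := by linarith [Real.add_one_le_exp (q : ℝ)]
  have hℓexp : (ℓ : ℝ) ≤ Real.exp ℓ := by linarith [Real.add_one_le_exp (ℓ : ℝ)]
  have hnexp : (n : ℝ) ≤ Real.exp ℓ := by
    have e1 : (n : ℝ) ≤ 2 ^ ℓ := by exact_mod_cast hnℓ
    have e2 : (2 : ℝ) ^ ℓ ≤ Real.exp 1 ^ ℓ :=
      pow_le_pow_left₀ (by norm_num) (by linarith [Real.exp_one_gt_d9]) _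
    rw [← Real.exp_nat_mul, mul_one] at e2
    exact e1.trans e2
  have hΩ' : (Fintype.card Ω : ℝ) ≤ Real.exp (q * n) := by
    calc (Fintype.card Ω : ℝ) ≤ (q : ℝ) ^ n := by exact_mod_cast hΩ
      _ ≤ Real.exp q ^ n := pow_le_pow_left₀ (by linarith) hqexp n
      _ = _ := by rw [← Real.exp_nat_mul, mul_comm]
  have hLr : (L : ℝ) ≤ n * q ^ 2 := by exact_mod_cast hL
  have hlogL : 1 + Real.log L ≤ (2 + 2 * q) * ℓ := by
    rcases Nat.eq_zero_or_pos L with h0 | hpos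
    · rw [h0, Nat.cast_zero, Real.log_zero]; nlinarith
    · have h1 : Real.log L ≤ Real.log (Real.exp (ℓ + 2 * q)) := by
        refine Real.log_le_log (by exact_mod_cast hpos) (hLr.trans ?_)
        calc (n : ℝ) * q ^ 2 ≤ Real.exp ℓ * Real.exp q ^ 2 := by gcongr
          _ = _ := by rw [← Real.exp_nat_mul, ← Real.exp_add]; norm_num
      rw [Real.log_exp] at h1
      nlinarith
  have hlog2 := Real.log_two_gt_d9
  have hlogn : Real.log 2 ≤ Real.log n := Real.log_le_log (by norm_num) hn2
  have hℓlog : (ℓ : ℝ) ≤ 3 * Real.log n := by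
    have h1 : 2 ^ (ℓ - 1) < n := Nat.pow_pred_clog_lt_self (by norm_num) hn
    have h2 : Real.log ((2 : ℝ) ^ (ℓ - 1)) ≤ Real.log n :=
      Real.log_le_log (by positivity) (by exact_mod_cast h1.le)
    rw [Real.log_pow, Nat.cast_sub hℓ, Nat.cast_one] at h2
    nlinarith
  -- sampling at a rate below `1 / n`
  have hfine : ∀ {η : ℝ}, 0 < η → η * n ≤ 1 → ∃ v : Y → ℝ, (∀ y, 0 ≤ v y) ∧
      ((univ.filter fun y => 0 < v y).card : ℝ) ≤
        4 * ((9 * q + 21) * ℓ ^ 3 / η ^ 2) * (n * q ^ 2) + 2 ∧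
      ∀ σ, |∑ y ∈ univ.filter (c σ), v y - ∑ y ∈ univ.filter (c σ), w y| ≤
        40 * η * ∑ y ∈ univ.filter (c σ), w y := by
    intro η hη hηn
    have hcov := hasCovers_of_small hr hw hq (by omega : 1 ≤ n) hΩ' hℓ0 hnexp hlogL hηn
      (univ.filter fun y => 0 < w y)
    obtain ⟨v, h1, h2, h3⟩ := exists_sparsifier_of_hasCovers hr hw hq (by omega) hℓ hnℓ hΩ' hL
      (by positivity) hη (by nlinarith) hcov
    refine ⟨v, h1, h2.trans ?_, h3⟩
    have e : (2 * ((q : ℝ) + 4) + 2 * (2 + 2 * q) + 3 * q + 9) = 9 * q + 21 := by ring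
    rw [e]
    gcongr
  -- A round then has relative error at most `40 η = ε / 5`; two rounds compose to at most `ε / 5 +
  -- 2 ε / 5 < ε`.
  set η : ℝ := ε / 200 with hη
  have hη0 : 0 < η := by positivity
  have hboth : ∃ v : Y → ℝ, (∀ y, 0 ≤ v y) ∧
      ((univ.filter fun y => 0 < v y).card : ℝ) ≤
        4 * ((13 * q + 35) * ℓ ^ 3 / η ^ 2) * (n * q ^ 2) + 2 ∧
      ∀ σ, |∑ y ∈ univ.filter (c σ), v y - ∑ y ∈ univ.filter (c σ), w y| ≤
        ε * ∑ y ∈ univ.filter (c σ), w y := by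
    rcases le_or_gt (η * n) 1 with hle | hgt
    · obtain ⟨v, h1, h2, h3⟩ := hfine hη0 hle
      refine ⟨v, h1, h2.trans ?_, fun σ => (h3 σ).trans ?_⟩
      · gcongr <;> norm_num
      · refine mul_le_mul_of_nonneg_right (by rw [hη]; linarith) (sum_nonneg fun y _ => hw y)
    -- When `η > 1 / n`, a preliminary round at accuracy parameter `1 / n` leaves polynomially many
    -- clauses, reweighted by `u`; exact covers then work for `u`.
    · obtain ⟨u, hu1, hu2, hu3⟩ := hfine (η := 1 / n) (by positivity)
        (by rw [one_div_mul_cancel (by linarith)])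
      have hcard : ((univ.filter fun y => 0 < u y).card : ℝ) + 1 ≤
          Real.exp ((3 * q + 11) * ℓ) := by
        have e5 : (123 : ℝ) ≤ Real.exp 5 := by
          have h2 : Real.exp 5 = Real.exp 1 ^ 5 := by rw [← Real.exp_nat_mul]; norm_num
          have h3 : (2.7 : ℝ) ^ 5 ≤ Real.exp 1 ^ 5 :=
            pow_le_pow_left₀ (by norm_num) (by linarith [Real.exp_one_gt_d9]) 5
          rw [h2]
          exact le_trans (by norm_num) h3
        have hX : (1 : ℝ) ≤ (ℓ ^ 3 * n ^ 3) * q ^ 2 := by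
          have := one_le_pow₀ hℓ0 (n := 3)
          have := one_le_pow₀ hn0 (n := 3)
          have := one_le_pow₀ hq0 (n := 2)
          exact one_le_mul_of_one_le_of_one_le
            (one_le_mul_of_one_le_of_one_le ‹_› ‹_›) ‹_›
        calc ((univ.filter fun y => 0 < u y).card : ℝ) + 1 ≤
            4 * ((9 * q + 21) * ℓ ^ 3 / (1 / n) ^ 2) * (n * q ^ 2) + 2 + 1 := by linarith
          _ = 4 * (9 * q + 21) * ((ℓ ^ 3 * n ^ 3) * q ^ 2) + 3 := by
              field_simp; ring
          _ ≤ 123 * q * ((ℓ ^ 3 * n ^ 3) * q ^ 2) := by nlinarith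
          _ = 123 * (ℓ ^ 3 * n ^ 3) * q ^ 3 := by ring
          _ ≤ Real.exp 5 * (Real.exp ℓ ^ 3 * Real.exp ℓ ^ 3) * Real.exp q ^ 3 := by gcongr
          _ = Real.exp (5 + 6 * ℓ + 3 * q) := by
              rw [← Real.exp_nat_mul, ← Real.exp_nat_mul, ← Real.exp_add, ← Real.exp_add,
                ← Real.exp_add]
              congr 1; push_cast; ring
          _ ≤ _ := Real.exp_le_exp.mpr (by nlinarith)
      have hcov := hasCovers_of_card hr hu1 (by positivity) (by linarith) hlogL hcard n η
      obtain ⟨v, h1, h2, h3⟩ := exists_sparsifier_of_hasCovers hr hu1 hq (by omega) hℓ hnℓ hΩ' hL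
        (by positivity) hη0 (by rw [hη]; linarith) hcov
      refine ⟨v, h1, h2.trans ?_, fun σ => ?_⟩
      · have e : (2 * (3 * (q : ℝ) + 11) + 2 * (2 + 2 * q) + 3 * q + 9) = 13 * q + 35 := by ring
        rw [e]
        gcongr
      · have hη' : 1 / (n : ℝ) ≤ η := by
          rw [div_le_iff₀ (by linarith)]; linarith
        have ha := abs_le.mp (h3 σ)
        have hb := abs_le.mp (hu3 σ)
        have hW : 0 ≤ ∑ y ∈ univ.filter (c σ), w y := sum_nonneg fun y _ => hw y
        set W := ∑ y ∈ univ.filter (c σ), w y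
        set W' := ∑ y ∈ univ.filter (c σ), u y
        have hb' : 40 * (1 / (n : ℝ)) * W ≤ ε / 5 * W :=
          mul_le_mul_of_nonneg_right (by rw [hη] at hη'; linarith) hW
        have e40 : 40 * η = ε / 5 := by rw [hη]; ring
        rw [e40] at ha
        have hεW : 0 ≤ ε * W := by positivity
        have hW' : W' ≤ 2 * W := by nlinarith
        have hεW' : ε * W' ≤ ε * (2 * W) := mul_le_mul_of_nonneg_left hW' hε.le
        rw [abs_le]
        constructor <;> linarith
  obtain ⟨v, h1, h2, h3⟩ := hboth
  refine ⟨v, h1, h2.trans ?_, h3⟩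
  have hlpos : 0 < Real.log n := by linarith
  -- The argument yields three logarithms; the sixth power follows since `log n ≥ log 2` makes `4
  -- (log n)^3` at least one.
  have hℓ3 : (ℓ : ℝ) ^ 3 ≤ 108 * Real.log n ^ 6 := by
    have e1 : (ℓ : ℝ) ^ 3 ≤ (3 * Real.log n) ^ 3 := pow_le_pow_left₀ (by linarith) hℓlog 3
    have e2 : (1 : ℝ) ≤ 4 * Real.log n ^ 3 := by
      have : (0.69 : ℝ) ^ 3 ≤ Real.log n ^ 3 := pow_le_pow_left₀ (by norm_num) (by linarith) 3
      norm_num at this ⊢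
      linarith
    have e3 : 0 ≤ Real.log n ^ 3 := by positivity
    calc (ℓ : ℝ) ^ 3 ≤ 27 * Real.log n ^ 3 * 1 := by linarith [mul_pow 3 (Real.log n) 3]
      _ ≤ 27 * Real.log n ^ 3 * (4 * Real.log n ^ 3) := by gcongr
      _ = _ := by ring
  have hone : 1 ≤ (ℓ : ℝ) ^ 3 * n / ε ^ 2 := by
    rw [le_div_iff₀ (by positivity), one_mul]
    have := one_le_pow₀ hℓ0 (n := 3)
    have : ε ^ 2 ≤ 1 := pow_le_one₀ hε.le hε1.le
    nlinarith
  calc 4 * ((13 * q + 35) * (ℓ : ℝ) ^ 3 / η ^ 2) * (n * q ^ 2) + 2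
      = 160000 * (13 * q + 35) * q ^ 2 * ((ℓ : ℝ) ^ 3 * n / ε ^ 2) + 2 := by
        rw [hη]; field_simp; ring
    _ ≤ (160000 * (13 * q + 35) * q ^ 2 + 2) * ((ℓ : ℝ) ^ 3 * n / ε ^ 2) := by linarith
    _ ≤ (160000 * (13 * q + 35) * q ^ 2 + 2) * ((108 * Real.log n ^ 6) * n / ε ^ 2) := by gcongr
    _ = _ := by ring

end Compose

/-! ### The fork rank of Mal'tsev-closed sets. -/

section Maltsev

open Finset
open scoped Classical

variable {D : Type*} [Fintype D] {n : ℕ}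

/-- The forks of a set of tuples: pairs of values taken at a position by two members of the set
that agree at all earlier positions. -/
noncomputable def forks (A : Finset (Fin n → D)) : Finset (Fin n × D × D) :=
  univ.filter fun x => ∃ u ∈ A, ∃ v ∈ A, (∀ j < x.1, u j = v j) ∧ u x.1 = x.2.1 ∧ v x.1 = x.2.2

theorem forks_mono {A B : Finset (Fin n → D)} (h : A ⊆ B) : forks A ⊆ forks B := by
  intro x hx
  obtain ⟨-, u, hu, v, hv, h1⟩ := mem_filter.mp hx
  exact mem_filter.mpr ⟨mem_univ _, u, h hu, v, h hv, h1⟩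

/-- A set of tuples closed under a Mal'tsev operator is determined by its forks. -/
theorem eq_of_forks_subset {φ : D → D → D → D} (hφ : IsMaltsevOp φ) (hn : 0 < n)
    {A B : Finset (Fin n → D)}
    (hA : ∀ a ∈ A, ∀ b ∈ A, ∀ d ∈ A, (fun i => φ (a i) (b i) (d i)) ∈ A) (hAB : A ⊆ B)
    (h : forks B ⊆ forks A) : A = B := by
  refine hAB.antisymm fun t ht => ?_
  -- `t` is rebuilt inside `A` coordinate by coordinate. If `s` agrees with `t` before `k`, the fork
  -- `(s k, t k)` is witnessed in `A` by some `u`, `v`, and `φ(s, u, v)` equals `s` where `u = v`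
  -- and `φ(s k, s k, t k) = t k` at `k`.
  have key : ∀ k ≤ n, ∃ s ∈ A, ∀ j : Fin n, j.1 < k → s j = t j := by
    intro k
    induction k with
    | zero =>
      intro _
      -- The trivial fork at position `0` shows that `A` is non-empty.
      have : ((⟨0, hn⟩ : Fin n), t ⟨0, hn⟩, t ⟨0, hn⟩) ∈ forks A :=
        h (mem_filter.mpr ⟨mem_univ _, t, ht, t, ht, fun _ _ => rfl, rfl, rfl⟩)
      obtain ⟨-, u, hu, -⟩ := mem_filter.mp this
      exact ⟨u, hu, fun j hj => absurd hj (Nat.not_lt_zero _)⟩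
    | succ k ih =>
      intro hk
      obtain ⟨s, hs, hst⟩ := ih (by omega)
      set i : Fin n := ⟨k, by omega⟩ with hi
      have : (i, s i, t i) ∈ forks A :=
        h (mem_filter.mpr ⟨mem_univ _, s, hAB hs, t, ht, fun j hj => hst j hj, rfl, rfl⟩)
      obtain ⟨-, u, hu, v, hv, huv, hui, hvi⟩ := mem_filter.mp this
      refine ⟨_, hA s hs u hu v hv, fun j hj => ?_⟩
      dsimp only at huv hui hvi ⊢
      rcases Nat.lt_succ_iff_lt_or_eq.mp hj with hlt | heq
      · rw [huv j hlt, (hφ (s j) (v j)).1, hst j hlt]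
      · have : j = i := Fin.ext heq
        rw [this, hui, hvi, (hφ (t i) (s i)).2]
  obtain ⟨s, hs, hst⟩ := key n le_rfl
  have : s = t := funext fun j => hst j j.2
  exact this ▸ hs

/-- The number of forks is a rank function for the complement of a Mal'tsev predicate. -/
theorem isRank_forks {r : ℕ} {R : Set (Fin r → D)} (hR : IsMaltsev R) (hn : 0 < n)
    (Y : Finset (Fin r → Fin n)) :
    IsRank (fun (σ : Fin n → D) (y : Y) => (fun i => σ (y.1 i)) ∈ Rᶜ) (fun A => (forks A).card)
      (n * Fintype.card D ^ 2) := by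
  obtain ⟨φ, hφ, hcl⟩ := hR
  refine ⟨fun S T hST => card_lt_card ((ssubset_iff_subset_ne).mpr
    ⟨forks_mono hST.subset, fun heq => ?_⟩), fun S => (card_le_univ _).trans (le_of_eq ?_)⟩
  -- A flat asks that certain restricted tuples lie in `R`, so it inherits closure under `φ`; nested
  -- flats with as many forks therefore coincide.
  · refine hST.ne (eq_of_forks_subset hφ hn (fun a ha b hb d hd => ?_) hST.subset heq.ge)
    rw [mem_sol] at ha hb hd ⊢
    intro y hy
    have h1 := ha y hy
    have h2 := hb y hy
    have h3 := hd y hy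
    simp only [Set.mem_compl_iff, not_not] at h1 h2 h3 ⊢
    exact hcl _ h1 _ h2 _ h3
  · simp only [Fintype.card_prod, Fintype.card_fin]; ring

theorem weightedSparsity_compl_le {r : ℕ} {R : Set (Fin r → D)} (hR : IsMaltsev R)
    (hn : 2 ≤ n) {ε : ℝ} (hε : 0 < ε) (hε1 : ε < 1) (Y : Finset (Fin r → Fin n)) {w : Y → ℝ}
    (hw : ∀ y, 0 < w y) {q : ℕ} (hq : 1 ≤ q) (hDq : Fintype.card D ≤ q) :
    (weightedSparsity Rᶜ Y w ε : ℝ) ≤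
      108 * (160000 * (13 * q + 35) * q ^ 2 + 2) * (n * Real.log n ^ 6 / ε ^ 2) := by
  obtain ⟨v, h1, h2, h3⟩ := exists_sparsifier (isRank_forks hR (by omega) Y)
    (fun y => (hw y).le) hq hn
    (by simpa using Nat.pow_le_pow_left hDq n)
    (Nat.mul_le_mul_left n (Nat.pow_le_pow_left hDq 2)) hε hε1
  have hwwt : ∀ (u : Y → ℝ) (σ : Fin n → D), wwt Rᶜ Y u σ =
      ∑ y ∈ univ.filter (fun y : Y => (fun i => σ (y.1 i)) ∈ Rᶜ), u y := by
    intro u σ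
    rw [wwt, sum_filter]
    refine sum_congr rfl fun y _ => ?_
    split_ifs <;> simp
  have hv : IsWeightedSparsifier Rᶜ Y w ε v := by
    refine ⟨h1, fun σ => ?_⟩
    have h : |wwt Rᶜ Y v σ - wwt Rᶜ Y w σ| ≤ ε * wwt Rᶜ Y w σ := by
      rw [hwwt, hwwt]; convert h3 σ
    have := abs_le.mp h
    constructor <;> linarith
  have hs : weightedSparsity Rᶜ Y w ε ≤ suppSize v := Nat.sInf_le ⟨v, hv, rfl⟩
  have hc : suppSize v = (univ.filter fun y => 0 < v y).card := by
    rw [suppSize, Set.ncard_eq_toFinset_card']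
    congr 1
    ext y
    simp
  rw [hc] at hs
  exact le_trans (by exact_mod_cast hs) h2

end Maltsev

end CSP

theorem mainTheorem11 (D : Type*) [Finite D] :
    ∃ C : ℝ, ∀ (r : ℕ) (R : Set (Fin r → D)), CSP.IsMaltsev R →
      ∀ (n : ℕ) (ε : ℝ), 2 ≤ n → 0 < ε → ε < 1 →
        (CSP.SPR Rᶜ n ε : ℝ) ≤ C * (n * Real.log n ^ 6 / ε ^ 2) ∧
        (CSP.wSPR Rᶜ n ε : ℝ) ≤ C * (n * Real.log n ^ 6 / ε ^ 2) := by
  have := Fintype.ofFinite D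
  -- Using `|D| + 1` keeps the parameter `q` at least `1` even when `D` is empty.
  refine ⟨108 * (160000 * (13 * (Fintype.card D + 1 : ℕ) + 35) * (Fintype.card D + 1 : ℕ) ^ 2 + 2),
    fun r R hR n ε hn hε hε1 => ⟨?_, ?_⟩⟩
  · obtain ⟨Y, hY⟩ := Nat.sSup_mem (s := {k | ∃ Y : Finset (Fin r → Fin n),
      CSP.sparsity Rᶜ Y ε = k}) ⟨_, ∅, rfl⟩ (CSP.bddAbove_SPR Rᶜ n hε.le)
    rw [CSP.SPR, ← hY, CSP.sparsity_eq]
    exact CSP.weightedSparsity_compl_le hR hn hε hε1 Y (fun _ => one_pos) (by omega) (by omega)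
  · obtain ⟨Y, w, hw, hY⟩ := Nat.sSup_mem (s := {k | ∃ (Y : Finset (Fin r → Fin n)) (w : Y → ℝ),
      (∀ y, 0 < w y) ∧ CSP.weightedSparsity Rᶜ Y w ε = k})
      ⟨_, ∅, fun _ => 1, fun _ => one_pos, rfl⟩ (CSP.bddAbove_wSPR Rᶜ n hε.le)
    rw [CSP.wSPR, ← hY]
    exact CSP.weightedSparsity_compl_le hR hn hε hε1 Y hw (by omega) (by omega)
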